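/- Let $l,m\ge1$ be integers and let $\{P_0,\dots,P_m\}$ be a symmetric Clifford system on $\mathbb R^{2l}$, i.e. $P_0,\dots,P_m$ are symmetric real $2l\times 2l$ matrices with $P_\alpha P_\beta+P_\beta P_\alpha=2\delta_{\alpha\beta}I_{2l}$. Put $$M_i=\{x\in S^{2l-1}(1): \langle P_0x,x\rangle=\dots=\langle P_ix,x\rangle=0\},\qquad N_i=\Big\{x\in S^{2l-1}(1): \sum_{\alpha=0}^i\langle P_\alpha x,x\rangle^2=1\Big\},$$ with the Riemannian metrics induced from $\mathbb R^{2l}$, and let $\Delta$ (the trace of the Hessian) be their Laplacians. A map $\varphi$ from a submanifold $M$ to $S^{n-1}(1)\subset\mathbb R^n$ is called an eigenmap with eigenvalue $\lambda$ if each of its $\mathbb R^n$-components $f$ is a smooth, not identically zero function on $M$ with $\Delta f=-\lambda f$. A map to a set $J(S^{n-1}(1))$, where $J$ is a linear isometric embedding of $\mathbb R^n$, is called a (submersive) eigenmap if it is one after composition with $J^{-1}$, for every such $J$. (1) Let $0\le i\le m-1$ and $i+2\le l$ (which holds automatically if $l-m-1\ge 0$). Then $M_{i+1}$ is a smooth embedded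 submanifold of dimension $2l-i-3$; the sets $\mathcal U_{\pm1}=\{y\in M_i:\langle P_{i+1}y,y\rangle=\pm1\}$ are the images of $S^{l-1}(1)\subset\mathbb R^l$ under linear isometric embeddings $\mathbb R^l\to\mathbb R^{2l}$; and both focal maps $$\phi_{\pm\frac{\pi}{4}}:M_{i+1}\to\mathcal U_{\pm1}\cong S^{l-1}(1),\qquad \phi_{\pm\frac\pi4}(x)=\tfrac1{\sqrt2}(x\pm P_{i+1}x),$$ are surjective submersive eigenmaps with the same eigenvalue $2l-i-3$. (2) Let $2\le i\le m$. Then $N_{i-1}$ is a smooth embedded submanifold of dimension $l+i-2$; the sets $\mathcal V_{\pm1}=\{y\in N_i:\langle P_iy,y\rangle=\pm1\}$ are the images of $S^{l-1}(1)\subset\mathbb R^l$ under linear isometric embeddings $\mathbb R^l\to\mathbb R^{2l}$; and both focal maps $$\psi_{\pm\frac{\pi}{4}}:N_{i-1}\to\mathcal V_{\pm1}\cong S^{l-1}(1),\qquad \psi_{\pm\frac\pi4}(x)=\tfrac1{\sqrt2}(x\pm P_ix),$$ are surjective submersive eigenmaps with the same eigenvalue $l+i-2$. -/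

import Mathlib

open scoped ContDiff

noncomputable section

namespace FocalEigenmap

/-! ### Submanifolds of a Euclidean space and their Laplacian

A submanifold is a subset `M` of a real inner product space `E`, always with the Riemannian metric
induced from `E`.  Functions and maps on `M` are given by functions on `E`, of which only the
values on `M` are ever used. -/

section Submanifold

variable {E : Type*} [NormedAddCommGroup E] [InnerProductSpace ℝ E]

/-- `ψ : U → M` is a smooth regular local parametrization of the subset `M` of `E` by an open
subset `U` of `ℝ^d`: a smooth immersion that is a homeomorphism onto an open subset of `M`. -/
structure IsLocalParam (M : Set E) (d : ℕ) (U : Set (EuclideanSpace ℝ (Fin d)))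
    (ψ : EuclideanSpace ℝ (Fin d) → E) : Prop where
  isOpen_source : IsOpen U
  contDiffOn : ContDiffOn ℝ ∞ ψ U
  injective_fderiv : ∀ u ∈ U, Function.Injective (fderiv ℝ ψ u)
  isEmbedding : Topology.IsEmbedding (U.domRestrict ψ)
  isOpen_image : ∃ W : Set E, IsOpen W ∧ ψ '' U = M ∩ W

/-- `M` is a smooth embedded `d`-dimensional submanifold of `E` (without boundary). -/
def IsEmbeddedSubmanifold (M : Set E) (d : ℕ) : Prop :=
  ∀ x ∈ M, ∃ (U : Set (EuclideanSpace ℝ (Fin d))) (ψ : EuclideanSpace ℝ (Fin d) → E),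
    IsLocalParam M d U ψ ∧ x ∈ ψ '' U

variable {F : Type*} [NormedAddCommGroup F] [NormedSpace ℝ F]

/-- The `i`-th partial derivative. -/
def partialDeriv {d : ℕ} (i : Fin d) (h : EuclideanSpace ℝ (Fin d) → F)
    (u : EuclideanSpace ℝ (Fin d)) : F :=
  fderiv ℝ h u (EuclideanSpace.single i 1)

/-- The matrix `g_{ij} = ⟨∂_i ψ, ∂_j ψ⟩` of the induced metric in the coordinates `ψ`. -/
def metricMatrix {d : ℕ} (ψ : EuclideanSpace ℝ (Fin d) → E) (u : EuclideanSpace ℝ (Fin d)) :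
    Matrix (Fin d) (Fin d) ℝ :=
  Matrix.of fun i j => inner ℝ (partialDeriv i ψ u) (partialDeriv j ψ u)

/-- The Christoffel symbol
`Γ^k_{ij} = 1/2 ∑_r g^{kr} (∂_i g_{jr} + ∂_j g_{ir} - ∂_r g_{ij})` of the induced metric. -/
def christoffel {d : ℕ} (ψ : EuclideanSpace ℝ (Fin d) → E) (k i j : Fin d)
    (u : EuclideanSpace ℝ (Fin d)) : ℝ :=
  (1 / 2 : ℝ) * ∑ r, (metricMatrix ψ u)⁻¹ k r *
    (partialDeriv i (fun v => metricMatrix ψ v j r) u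
      + partialDeriv j (fun v => metricMatrix ψ v i r) u
      - partialDeriv r (fun v => metricMatrix ψ v i j) u)

/-- The Laplace-Beltrami operator (trace of the Hessian) of the induced metric, in the coordinates
`ψ`: `Δf = ∑_{i,j} g^{ij} (∂_i ∂_j f - ∑_k Γ^k_{ij} ∂_k f)`, evaluated at the point `ψ u`. -/
def laplaceBeltrami {d : ℕ} (ψ : EuclideanSpace ℝ (Fin d) → E) (f : E → ℝ)
    (u : EuclideanSpace ℝ (Fin d)) : ℝ :=
  ∑ i, ∑ j, (metricMatrix ψ u)⁻¹ i j *
    (partialDeriv i (partialDeriv j (f ∘ ψ)) u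
      - ∑ k, christoffel ψ k i j u * partialDeriv k (f ∘ ψ) u)

/-- `f` restricts to a (smooth, not identically zero) eigenfunction of the Laplacian of the
`d`-dimensional submanifold `M`, with eigenvalue `μ`: `Δf = -μ f`. -/
structure IsLaplaceEigenfunction (M : Set E) (d : ℕ) (f : E → ℝ) (μ : ℝ) : Prop where
  smooth : ∀ U ψ, IsLocalParam M d U ψ → ContDiffOn ℝ ∞ (f ∘ ψ) U
  ne_zero : ∃ x ∈ M, f x ≠ 0
  eigen : ∀ U ψ, IsLocalParam M d U ψ → ∀ u ∈ U, laplaceBeltrami ψ f u = -μ * f (ψ u)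

/-- `φ` restricts to an eigenmap from the `d`-dimensional submanifold `M` to the unit sphere of
`ℝ^n`, with eigenvalue `μ`. -/
structure IsEigenmap (M : Set E) (d : ℕ) {n : ℕ} (φ : E → EuclideanSpace ℝ (Fin n)) (μ : ℝ) :
    Prop where
  mapsTo : Set.MapsTo φ M (Metric.sphere 0 1)
  eigen : ∀ k, IsLaplaceEigenfunction M d (fun x => φ x k) μ

/-- `φ` restricts to a submersion from the `d`-dimensional submanifold `M` to the unit sphere of
`ℝ^n`: its differential at each `x ∈ M` maps `T_x M` onto the tangent space `φ(x)^⊥` of the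
sphere. -/
def IsSubmersionToSphere (M : Set E) (d : ℕ) {n : ℕ} (φ : E → EuclideanSpace ℝ (Fin n)) : Prop :=
  ∀ U ψ, IsLocalParam M d U ψ → ∀ u ∈ U,
    Set.range (fderiv ℝ (φ ∘ ψ) u) = {w | inner ℝ (φ (ψ u)) w = 0}

/-- The subset `S` of `E` is a copy of the unit sphere `S^{n-1}(1)` of `ℝ^n` (the image of this
sphere under a linear isometric embedding), `φ` maps `M` onto `S`, and after any such
identification of `S` with `S^{n-1}(1)` it is a submersive eigenmap from the `d`-dimensional
submanifold `M` to `S^{n-1}(1)`, with eigenvalue `μ`. -/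
structure IsSubmersiveEigenmapOnto (M : Set E) (d : ℕ) (n : ℕ) (φ : E → E) (S : Set E) (μ : ℝ) :
    Prop where
  isSphere : ∃ J : EuclideanSpace ℝ (Fin n) →ₗᵢ[ℝ] E, J '' Metric.sphere 0 1 = S
  image_eq : φ '' M = S
  eigenmap : ∀ J : EuclideanSpace ℝ (Fin n) →ₗᵢ[ℝ] E, J '' Metric.sphere 0 1 = S →
    ∃ Φ : E → EuclideanSpace ℝ (Fin n), (∀ x ∈ M, J (Φ x) = φ x) ∧
      IsEigenmap M d Φ μ ∧ IsSubmersionToSphere M d Φ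

end Submanifold

/-! ### Symmetric Clifford systems -/

section Clifford

variable {m l : ℕ}

/-- `P_0, …, P_m` is a symmetric Clifford system on `ℝ^{2l}`: the `P_α` are symmetric and
`P_α P_β + P_β P_α = 2 δ_{αβ} I`. -/
structure IsSymmetricCliffordSystem (P : Fin (m + 1) → Matrix (Fin (2 * l)) (Fin (2 * l)) ℝ) :
    Prop where
  symm : ∀ α, (P α).IsSymm
  anticomm : ∀ α β, P α * P β + P β * P α = (if α = β then (2 : ℝ) else 0) • 1

/-- The quadratic form `⟨A x, x⟩`. -/
def quadForm (A : Matrix (Fin (2 * l)) (Fin (2 * l)) ℝ) (x : EuclideanSpace ℝ (Fin (2 * l))) : ℝ :=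
  inner ℝ (Matrix.toEuclideanLin A x) x

/-- `M_i = {x ∈ S^{2l-1}(1) : ⟨P_0 x, x⟩ = ⋯ = ⟨P_i x, x⟩ = 0}` (for `i ≤ m`). -/
def cliffordM (P : Fin (m + 1) → Matrix (Fin (2 * l)) (Fin (2 * l)) ℝ) (i : ℕ) :
    Set (EuclideanSpace ℝ (Fin (2 * l))) :=
  {x | x ∈ Metric.sphere 0 1 ∧ ∀ α : Fin (m + 1), (α : ℕ) ≤ i → quadForm (P α) x = 0}

/-- `N_i = {x ∈ S^{2l-1}(1) : ⟨P_0 x, x⟩² + ⋯ + ⟨P_i x, x⟩² = 1}` (for `i ≤ m`). -/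
def cliffordN (P : Fin (m + 1) → Matrix (Fin (2 * l)) (Fin (2 * l)) ℝ) (i : ℕ) :
    Set (EuclideanSpace ℝ (Fin (2 * l))) :=
  {x | x ∈ Metric.sphere 0 1 ∧
    ∑ α : Fin (m + 1) with α.val ≤ i, quadForm (P α) x ^ 2 = 1}

/-- The map `x ↦ (x + ε A x) / √2`, where `ε = ±1`. -/
def focalMap (A : Matrix (Fin (2 * l)) (Fin (2 * l)) ℝ) (ε : ℝ)
    (x : EuclideanSpace ℝ (Fin (2 * l))) : EuclideanSpace ℝ (Fin (2 * l)) :=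
  (1 / √2 : ℝ) • (x + ε • Matrix.toEuclideanLin A x)

end Clifford

end FocalEigenmap

end

/-! The eigenvalue equation is Takahashi's theorem: on a `d`-dimensional minimal submanifold of a
unit sphere, the restriction of every linear function satisfies `Δf = -d f`. The focal maps are
restrictions of linear maps `(1 + ε B) / √2`, so it suffices that `M_{i+1}` and `N_{i-1}` are
minimal in the sphere and that their dimensions are the stated eigenvalues.

Minimality is checked without charts. Let `proj x` be the orthogonal projection onto the tangent
space. Differentiating `proj w = w` along a tangent field `w` shows that `dproj x v w` is the second
fundamental form in Euclidean space on tangent `v`, `w`. Its trace must be `-d x`, which is the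
field `minimal` of `MinimalTangentData`; `laplaceBeltrami_clm` turns this into the eigenvalue
equation.

For `M_i` (`zeroSet`) the vectors `x`, `A_α x` form an orthonormal normal frame. The trace reduces
to `tr (A_α proj) = 0`, a consequence of `tr A_α = 0`, which holds because an anticommuting
involution conjugates `A_α` to its negative.

For `N_i` (`unitSet`) put `q_α = ⟨A_α x, x⟩` and `T = ∑ q_α A_α`. Then `T² = |q|²`, and the equality
case of Cauchy–Schwarz gives `T x = x`. So the points of `N_i` are the unit vectors fixed by some `∑
c_α A_α` with `|c| = 1`. The tangent space at `x` consists of the part of the `1`-eigenspace of `T`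
orthogonal to `x`, together with the span of the `A_α x - q_α x`. This gives an explicit projection
whose traces are computable.

The map `(1 + ε B) / √2` is `√2` times the projection onto the `ε`-eigenspace of `B`, and operators
anticommuting with `B` exchange its two eigenspaces. Preimages of points and lifts of tangent
vectors are found by adding suitable vectors of the opposite eigenspace, which the map kills. For
`M_{i+1}` the preimages come from a dimension count that uses `i + 2 ≤ l`. -/

open scoped ContDiff

namespace FocalEigenmap

open Topology Filter

/-! ### Local parametrizations from straightening maps and from retractions. -/

section Charts

variable {E : Type*} [NormedAddCommGroup E] [InnerProductSpace ℝ E] [FiniteDimensional ℝ E]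

/-- A local diffeomorphism that straightens `M` to a `d`-dimensional linear subspace `V` yields a
local parametrization of `M`. -/
theorem exists_isLocalParam_of_straightening {M : Set E} {d : ℕ} {x : E} (hx : x ∈ M)
    {O : Set E} (hO : IsOpen O) (hxO : x ∈ O) {Θ : E → E} (hΘ : ContDiffOn ℝ ∞ Θ O)
    (hΘx : HasFDerivAt Θ (ContinuousLinearMap.id ℝ E) x)
    {V : Submodule ℝ E} (hV : Module.finrank ℝ V = d)
    (hM : ∀ᶠ z in 𝓝 x, z ∈ M ↔ Θ z ∈ V) :
    ∃ (U : Set (EuclideanSpace ℝ (Fin d))) (ψ : EuclideanSpace ℝ (Fin d) → E),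
      IsLocalParam M d U ψ ∧ x ∈ ψ '' U := by
  have hcd : ∀ z ∈ O, ContDiffAt ℝ ∞ Θ z := fun z hz => hΘ.contDiffAt (hO.mem_nhds hz)
  have hΘx' : HasFDerivAt Θ ((ContinuousLinearEquiv.refl ℝ E : E ≃L[ℝ] E) : E →L[ℝ] E) x := hΘx
  set e := (hcd x hxO).toOpenPartialHomeomorph Θ hΘx' (by simp) with he
  have hecoe : (e : E → E) = Θ := rfl
  have hxe : x ∈ e.source := (hcd x hxO).mem_toOpenPartialHomeomorph_source hΘx' (by simp)
  obtain ⟨W₁, hW₁, hW₁o, hxW₁⟩ := eventually_nhds_iff.1 hM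
  -- The chart must be a smooth immersion at every point, not only at `x`, so the local inverse is
  -- restricted to the open set where the differential of `Θ` is invertible.
  set D : Set E := O ∩ fderiv ℝ Θ ⁻¹' Set.range
    (ContinuousLinearEquiv.toContinuousLinearMap : (E ≃L[ℝ] E) → E →L[ℝ] E) with hD
  have hDo : IsOpen D :=
    (hΘ.continuousOn_fderiv_of_isOpen hO (by simp)).isOpen_inter_preimage hO
      ContinuousLinearEquiv.isOpen
  have hxD : x ∈ D := ⟨hxO, ⟨ContinuousLinearEquiv.refl ℝ E, hΘx'.fderiv.symm⟩⟩
  set e' := e.restrOpen (D ∩ W₁) (hDo.inter hW₁o) with he'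
  have hsrc : e'.source = e.source ∩ (D ∩ W₁) := by simp [he']
  have he'coe : (e' : E → E) = Θ := rfl
  have hxe' : x ∈ e'.source := by rw [hsrc]; exact ⟨hxe, hxD, hxW₁⟩
  let B : EuclideanSpace ℝ (Fin d) ≃L[ℝ] V :=
    ContinuousLinearEquiv.ofFinrankEq (by rw [hV]; simp)
  let j : EuclideanSpace ℝ (Fin d) →L[ℝ] E := V.subtypeL ∘L (B : _ →L[ℝ] V)
  have hjV : ∀ u, j u ∈ V := fun u => (B u).2
  have hjs : ∀ v ∈ V, ∃ u, j u = v := fun v hv => ⟨B.symm ⟨v, hv⟩, by simp [j]⟩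
  have hjinj : Function.Injective j := Subtype.val_injective.comp B.injective
  have hjemb : IsEmbedding j := IsEmbedding.subtypeVal.comp B.toHomeomorph.isEmbedding
  have hcdU : ∀ u ∈ j ⁻¹' e'.target, ContDiffAt ℝ ∞ (e'.symm ∘ j) u ∧
      ∃ A : E ≃L[ℝ] E, HasFDerivAt (e'.symm ∘ j) ((A : E →L[ℝ] E) ∘L j) u := by
    intro u hu
    have hz : e'.symm (j u) ∈ e'.source := e'.map_target hu
    rw [hsrc] at hz
    obtain ⟨A, hA⟩ := hz.2.1.2
    have h1 : HasFDerivAt e' (A : E →L[ℝ] E) (e'.symm (j u)) := by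
      rw [he'coe, hA]
      exact ((hcd _ hz.2.1.1).differentiableAt (by simp)).hasFDerivAt
    refine ⟨(e'.contDiffAt_symm hu h1 (hcd _ hz.2.1.1)).comp u j.contDiff.contDiffAt, A.symm, ?_⟩
    exact (e'.hasFDerivAt_symm hu h1).comp u j.hasFDerivAt
  refine ⟨j ⁻¹' e'.target, e'.symm ∘ j, ⟨?_, ?_, ?_, ?_, ?_⟩, ?_⟩
  · exact e'.open_target.preimage j.continuous
  · exact fun u hu => (hcdU u hu).1.contDiffWithinAt
  · intro u hu
    obtain ⟨A, hA⟩ := (hcdU u hu).2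
    rw [hA.fderiv]
    exact A.injective.comp hjinj
  · have h1 : IsEmbedding (e'.symm.source.domRestrict e'.symm) :=
      e'.symm.isOpenEmbedding_restrict.isEmbedding
    have h2 : Set.MapsTo j (j ⁻¹' e'.target) e'.symm.source := fun u hu => hu
    exact h1.comp (hjemb.restrict h2)
  · refine ⟨e'.source, e'.open_source, ?_⟩
    ext z
    constructor
    · rintro ⟨u, hu, rfl⟩
      have hz : e'.symm (j u) ∈ e'.source := e'.map_target hu
      refine ⟨?_, hz⟩
      rw [hsrc] at hz
      refine (hW₁ _ hz.2.2).2 ?_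
      have : Θ (e'.symm (j u)) = j u := e'.right_inv hu
      simpa [this] using hjV u
    · rintro ⟨hzM, hz⟩
      have hz' := hz
      rw [hsrc] at hz'
      obtain ⟨u, hu⟩ := hjs _ ((hW₁ _ hz'.2.2).1 hzM)
      refine ⟨u, ?_, ?_⟩
      · simp only [Set.mem_preimage, hu]
        exact e'.map_source hz
      · simp only [Function.comp, hu]
        exact e'.left_inv hz
  · have hz' := hxe'
    rw [hsrc] at hz'
    obtain ⟨u, hu⟩ := hjs _ ((hW₁ _ hz'.2.2).1 hx)
    refine ⟨u, ?_, ?_⟩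
    · simp only [Set.mem_preimage, hu]
      exact e'.map_source hxe'
    · simp only [Function.comp, hu]
      exact e'.left_inv hxe'

/-- If `r` is a smooth retraction of a neighbourhood of `x` onto `M` and its differential at `x`
has rank `d`, then `M` has a `d`-dimensional local parametrization around `x`. -/
theorem exists_isLocalParam_of_retraction {M : Set E} {d : ℕ} {x : E} (hx : x ∈ M)
    {O : Set E} (hO : IsOpen O) (hxO : x ∈ O) {r : E → E} (hr : ContDiffOn ℝ ∞ r O)
    (hrM : Set.MapsTo r O M) (hfix : ∀ z ∈ M, r z = z)
    (hd : Module.finrank ℝ (LinearMap.range (fderiv ℝ r x).toLinearMap) = d) :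
    ∃ (U : Set (EuclideanSpace ℝ (Fin d))) (ψ : EuclideanSpace ℝ (Fin d) → E),
      IsLocalParam M d U ψ ∧ x ∈ ψ '' U := by
  set R := fderiv ℝ r x with hR
  have hrx : r x = x := hfix x hx
  have hrd : HasFDerivAt r R x :=
    ((hr.contDiffAt (hO.mem_nhds hxO)).differentiableAt (by simp)).hasFDerivAt
  -- Differentiate `r ∘ r = r` at the fixed point `x`.
  have hRR : R ∘L R = R := by
    have h1 : HasFDerivAt (r ∘ r) (R ∘L R) x := by
      refine HasFDerivAt.comp x ?_ hrd
      rwa [hrx]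
    have h2 : r ∘ r =ᶠ[𝓝 x] r := by
      filter_upwards [hO.mem_nhds hxO] with z hz using hfix _ (hrM hz)
    exact h1.unique (hrd.congr_of_eventuallyEq h2)
  have hRR' : ∀ v, R (R v) = R v := fun v => congrArg (fun T : E →L[ℝ] E => T v) hRR
  -- The `range R` component records `r z`, the complementary one the deviation of `z` from `r z`.
  -- The differential at `x` is `R² + (1 - R)² = 1`.
  set Θ : E → E := fun z => R (r z - x) + ((z - r z) - R (z - r z)) with hΘ
  have hΘs : ContDiffOn ℝ ∞ Θ O := by
    have hid : ContDiffOn ℝ ∞ (fun z => z - r z) O := contDiffOn_id.sub hr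
    exact (R.contDiff.comp_contDiffOn (hr.sub contDiffOn_const)).add
      (hid.sub (R.contDiff.comp_contDiffOn hid))
  have hΘd : HasFDerivAt Θ (ContinuousLinearMap.id ℝ E) x := by
    have hid : HasFDerivAt (fun z => z - r z) (ContinuousLinearMap.id ℝ E - R) x :=
      (hasFDerivAt_id x).sub hrd
    have h := (R.hasFDerivAt.comp x (hrd.sub_const x)).add
      (hid.sub (R.hasFDerivAt.comp x hid))
    refine h.congr_fderiv ?_
    ext v
    simp [hRR']
  refine exists_isLocalParam_of_straightening hx hO hxO hΘs hΘd hd ?_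
  have hstrict : HasStrictFDerivAt Θ (ContinuousLinearMap.id ℝ E) x := by
    have := (hΘs.contDiffAt (hO.mem_nhds hxO)).hasStrictFDerivAt (by simp)
    rwa [hΘd.fderiv] at this
  have hstrict' : HasStrictFDerivAt Θ
      ((ContinuousLinearEquiv.refl ℝ E : E ≃L[ℝ] E) : E →L[ℝ] E) x := hstrict
  set e := hstrict'.toOpenPartialHomeomorph Θ
  have hxe : x ∈ e.source := hstrict'.mem_toOpenPartialHomeomorph_source
  have hinj : Set.InjOn Θ e.source := e.injOn
  have hrc : Tendsto r (𝓝 x) (𝓝 x) := by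
    have := hrd.continuousAt.tendsto
    rwa [hrx] at this
  filter_upwards [hO.mem_nhds hxO, e.open_source.mem_nhds hxe,
    hrc (e.open_source.mem_nhds hxe)] with z hzO hz hrz
  constructor
  · intro hzM
    exact ⟨z - x, by simp [hΘ, hfix z hzM]⟩
  · rintro ⟨w, hw⟩
    have hw' : R w = Θ z := hw
    have hker : z - r z - R (z - r z) = 0 := by
      have h1 : R (Θ z) = Θ z := by rw [← hw', hRR']
      have h2 : R (Θ z) = R (r z - x) := by simp [hΘ, hRR']
      rw [h2] at h1
      simpa [hΘ] using h1
    -- When the deviation term vanishes, `z` and `r z` have the same image, and local injectivity of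
    -- `Θ` forces `z = r z ∈ M`.
    have hΘeq : Θ (r z) = Θ z := by
      have hrr : r (r z) = r z := hfix _ (hrM hzO)
      simp only [hΘ, hrr, hker, sub_self, map_zero]
    rw [← hinj hrz hz hΘeq]
    exact hrM hzO

end Charts

/-! ### The Laplacian of linear functions on minimal submanifolds of the sphere. -/

section Laplacian

variable {E : Type*} [NormedAddCommGroup E] [InnerProductSpace ℝ E]

theorem IsLocalParam.contDiffAt {M : Set E} {d : ℕ} {U : Set (EuclideanSpace ℝ (Fin d))}
    {ψ : EuclideanSpace ℝ (Fin d) → E} (h : IsLocalParam M d U ψ)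
    {u : EuclideanSpace ℝ (Fin d)} (hu : u ∈ U) : ContDiffAt ℝ ∞ ψ u :=
  h.contDiffOn.contDiffAt (h.isOpen_source.mem_nhds hu)

theorem IsLocalParam.mem {M : Set E} {d : ℕ} {U : Set (EuclideanSpace ℝ (Fin d))}
    {ψ : EuclideanSpace ℝ (Fin d) → E} (h : IsLocalParam M d U ψ)
    {u : EuclideanSpace ℝ (Fin d)} (hu : u ∈ U) : ψ u ∈ M := by
  obtain ⟨W, -, hW⟩ := h.isOpen_image
  exact (hW ▸ Set.mem_image_of_mem ψ hu : ψ u ∈ M ∩ W).1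

variable {F : Type*} [NormedAddCommGroup F] [NormedSpace ℝ F] {d : ℕ}

theorem hasDerivAt_add_smul (x v : F) : HasDerivAt (fun t : ℝ => x + t • v) v 0 := by
  simpa using ((hasDerivAt_id (0 : ℝ)).smul_const v).const_add x

theorem hasDerivAt_line {G : Type*} [NormedAddCommGroup G] [NormedSpace ℝ G] {h : G → F} {u : G}
    (hh : DifferentiableAt ℝ h u) (v : G) :
    HasDerivAt (fun t : ℝ => h (u + t • v)) (fderiv ℝ h u v) 0 := by
  have h2 : HasFDerivAt h (fderiv ℝ h u) (u + (0 : ℝ) • v) := by simpa using hh.hasFDerivAt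
  exact h2.comp_hasDerivAt 0 (hasDerivAt_add_smul u v)

theorem eventually_line_mem {U : Set (EuclideanSpace ℝ (Fin d))} (hU : IsOpen U)
    {u : EuclideanSpace ℝ (Fin d)} (hu : u ∈ U) (v : EuclideanSpace ℝ (Fin d)) :
    ∀ᶠ t : ℝ in 𝓝 0, u + t • v ∈ U := by
  have : ContinuousAt (fun t : ℝ => u + t • v) 0 := by fun_prop
  exact this.preimage_mem_nhds (by simpa using hU.mem_nhds hu)

theorem contDiffAt_partialDeriv {h : EuclideanSpace ℝ (Fin d) → F}
    {u : EuclideanSpace ℝ (Fin d)} (hh : ContDiffAt ℝ ∞ h u) (i : Fin d) :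
    ContDiffAt ℝ ∞ (partialDeriv i h) u :=
  (hh.fderiv_right (m := ∞) (by simp)).clm_apply contDiffAt_const

theorem partialDeriv_comm {h : EuclideanSpace ℝ (Fin d) → F}
    {u : EuclideanSpace ℝ (Fin d)} (hh : ContDiffAt ℝ ∞ h u) (i j : Fin d) :
    partialDeriv i (partialDeriv j h) u = partialDeriv j (partialDeriv i h) u := by
  have hd : DifferentiableAt ℝ (fderiv ℝ h) u :=
    (hh.fderiv_right (m := ∞) (by simp)).differentiableAt (by simp)
  have key : ∀ v w, fderiv ℝ (fun x => fderiv ℝ h x v) u w = fderiv ℝ (fderiv ℝ h) u w v := by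
    intro v w
    rw [fderiv_clm_apply hd (differentiableAt_const v)]
    simp
  have hs : IsSymmSndFDerivAt ℝ h u := hh.isSymmSndFDerivAt
    (by simpa using WithTop.coe_le_coe.2 (le_top : (2 : ℕ∞) ≤ ⊤))
  unfold partialDeriv
  rw [key, key]
  exact hs _ _

theorem partialDeriv_clm_comp {h : EuclideanSpace ℝ (Fin d) → E}
    {u : EuclideanSpace ℝ (Fin d)} (hh : DifferentiableAt ℝ h u) (f : E →L[ℝ] F) (i : Fin d) :
    partialDeriv i (f ∘ h) u = f (partialDeriv i h u) := by
  unfold partialDeriv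
  rw [fderiv_comp u f.differentiableAt hh]
  simp

/-- In terms of the second derivatives of `ψ`, the Christoffel symbols are
`Γ^k_{ij} = ∑_r g^{kr} ⟨∂_i ∂_j ψ, ∂_r ψ⟩`. -/
theorem christoffel_eq {ψ : EuclideanSpace ℝ (Fin d) → E} {u : EuclideanSpace ℝ (Fin d)}
    (hψ : ContDiffAt ℝ ∞ ψ u) (k i j : Fin d) :
    christoffel ψ k i j u = ∑ r, (metricMatrix ψ u)⁻¹ k r *
      inner ℝ (partialDeriv i (partialDeriv j ψ) u) (partialDeriv r ψ u) := by
  have hd : ∀ a, DifferentiableAt ℝ (partialDeriv a ψ) u := fun a =>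
    (contDiffAt_partialDeriv hψ a).differentiableAt (by simp)
  have key : ∀ a b c, partialDeriv a (fun v => metricMatrix ψ v b c) u =
      inner ℝ (partialDeriv b ψ u) (partialDeriv a (partialDeriv c ψ) u) +
      inner ℝ (partialDeriv a (partialDeriv b ψ) u) (partialDeriv c ψ u) := by
    intro a b c
    have := fderiv_inner_apply ℝ (hd b) (hd c) (EuclideanSpace.single a 1)
    exact this
  unfold christoffel
  rw [Finset.mul_sum]
  refine Finset.sum_congr rfl fun r _ => ?_
  -- By symmetry of second derivatives, four of the six terms cancel and the other two coincide,
  -- absorbing the factor `1 / 2`.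
  rw [key, key, key, partialDeriv_comm hψ j i, partialDeriv_comm hψ r j,
    partialDeriv_comm hψ r i, real_inner_comm (partialDeriv i (partialDeriv r ψ) u),
    real_inner_comm (partialDeriv j (partialDeriv r ψ) u)]
  ring_nf

/-- A subset of the unit sphere with a smooth family `proj` of orthogonal projections onto its
tangent spaces; `dproj x v w` is the derivative of `x ↦ proj x w` in the direction `v`, and
`minimal` says that the submanifold is minimal in the sphere. -/
structure MinimalTangentData (M : Set E) (d : ℕ) (proj : E → E →ₗ[ℝ] E)
    (dproj : E → E →ₗ[ℝ] E →ₗ[ℝ] E) : Prop where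
  symm : ∀ x ∈ M, (proj x).IsSymmetric
  finrank_range : ∀ x ∈ M, Module.finrank ℝ (LinearMap.range (proj x)) = d
  tangent : ∀ (c : ℝ → E) (v : E), (∀ᶠ t in 𝓝 0, c t ∈ M) → HasDerivAt c v 0 →
    proj (c 0) v = v
  hasDerivAt : ∀ (y w : ℝ → E) (y' w' : E), HasDerivAt y y' 0 → HasDerivAt w w' 0 →
    HasDerivAt (fun t => proj (y t) (w t)) (dproj (y 0) y' (w 0) + proj (y 0) w') 0
  minimal : ∀ x ∈ M, ∀ {ι : Type} [Fintype ι] (b : OrthonormalBasis ι ℝ E),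
    ∑ k, dproj x (proj x (b k)) (b k) = -(d : ℝ) • x

namespace MinimalTangentData

variable {M : Set E} {proj : E → E →ₗ[ℝ] E} {dproj : E → E →ₗ[ℝ] E →ₗ[ℝ] E}
  {U : Set (EuclideanSpace ℝ (Fin d))} {ψ : EuclideanSpace ℝ (Fin d) → E}
  {u : EuclideanSpace ℝ (Fin d)}

theorem proj_fderiv (D : MinimalTangentData M d proj dproj) (h : IsLocalParam M d U ψ)
    (hu : u ∈ U) (v : EuclideanSpace ℝ (Fin d)) :
    proj (ψ u) (fderiv ℝ ψ u v) = fderiv ℝ ψ u v := by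
  have h1 := D.tangent (fun t => ψ (u + t • v)) _
    ((eventually_line_mem h.isOpen_source hu v).mono fun t ht => h.mem ht)
    (hasDerivAt_line ((h.contDiffAt hu).differentiableAt (by simp)) v)
  simpa using h1

/-- One inclusion is `proj_fderiv`; both spaces have dimension `d`, since `ψ` is an immersion. -/
theorem range_fderiv [FiniteDimensional ℝ E] (D : MinimalTangentData M d proj dproj)
    (h : IsLocalParam M d U ψ) (hu : u ∈ U) :
    LinearMap.range (fderiv ℝ ψ u).toLinearMap = LinearMap.range (proj (ψ u)) := by
  refine Submodule.eq_of_le_of_finrank_eq ?_ ?_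
  · rintro _ ⟨v, rfl⟩
    exact ⟨_, D.proj_fderiv h hu v⟩
  · rw [D.finrank_range _ (h.mem hu),
      LinearMap.finrank_range_of_inj (h.injective_fderiv u hu)]
    simp

theorem fderiv_eq_sum (u v : EuclideanSpace ℝ (Fin d)) :
    fderiv ℝ ψ u v = ∑ i, v i • partialDeriv i ψ u := by
  conv_lhs => rw [← (EuclideanSpace.basisFun (Fin d) ℝ).sum_repr v]
  simp [partialDeriv]

theorem isUnit_det_metricMatrix (h : IsLocalParam M d U ψ) (hu : u ∈ U) :
    IsUnit (metricMatrix ψ u).det := by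
  have hli : LinearIndependent ℝ fun i => partialDeriv i ψ u := by
    rw [Fintype.linearIndependent_iff]
    intro g hg
    have h1 : fderiv ℝ ψ u (WithLp.toLp 2 g) = 0 := by rw [fderiv_eq_sum]; exact hg
    have h2 := h.injective_fderiv u hu (h1.trans (map_zero _).symm)
    intro i
    exact congrFun (congrArg WithLp.ofLp h2) i
  exact isUnit_iff_ne_zero.2 (Matrix.posDef_gram_of_linearIndependent hli).det_pos.ne'

/-- The orthogonal projection onto the tangent space in terms of the induced metric. -/
theorem proj_eq_sum [FiniteDimensional ℝ E] (D : MinimalTangentData M d proj dproj)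
    (h : IsLocalParam M d U ψ) (hu : u ∈ U) (w : E) :
    proj (ψ u) w = ∑ k, (∑ r, (metricMatrix ψ u)⁻¹ k r * inner ℝ w (partialDeriv r ψ u)) •
      partialDeriv k ψ u := by
  have hw : proj (ψ u) w ∈ LinearMap.range (fderiv ℝ ψ u).toLinearMap := by
    rw [D.range_fderiv h hu]
    exact ⟨w, rfl⟩
  obtain ⟨c, hc⟩ := hw
  replace hc : ∑ j, c j • partialDeriv j ψ u = proj (ψ u) w := by
    rw [← hc]; exact (fderiv_eq_sum u c).symm
  have h1 : ∀ r, inner ℝ w (partialDeriv r ψ u) = ∑ j, metricMatrix ψ u r j * c j := by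
    intro r
    have h2 : proj (ψ u) (partialDeriv r ψ u) = partialDeriv r ψ u := D.proj_fderiv h hu _
    rw [← h2, ← D.symm _ (h.mem hu), ← hc, sum_inner]
    refine Finset.sum_congr rfl fun j _ => ?_
    rw [real_inner_smul_left, real_inner_comm, mul_comm]
    rfl
  rw [← hc]
  refine Finset.sum_congr rfl fun k _ => ?_
  congr 1
  have h3 : (metricMatrix ψ u)⁻¹.mulVec ((metricMatrix ψ u).mulVec c) k = c k := by
    rw [Matrix.mulVec_mulVec, Matrix.nonsing_inv_mul _ (isUnit_det_metricMatrix h hu),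
      Matrix.one_mulVec]
  simp only [h1]
  exact h3.symm

/-- The restrictions of linear functions to a `d`-dimensional minimal submanifold of the unit
sphere satisfy `Δf = -d f`. -/
theorem laplaceBeltrami_clm [FiniteDimensional ℝ E] (D : MinimalTangentData M d proj dproj)
    (h : IsLocalParam M d U ψ) (hu : u ∈ U) (f : E →L[ℝ] ℝ) :
    laplaceBeltrami ψ f u = -(d : ℝ) * f (ψ u) := by
  have hψ := h.contDiffAt hu
  have hsecond : ∀ i j, partialDeriv i (partialDeriv j (f ∘ ψ)) u =
      f (partialDeriv i (partialDeriv j ψ) u) := by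
    intro i j
    have h1 : partialDeriv j (f ∘ ψ) =ᶠ[𝓝 u] f ∘ partialDeriv j ψ := by
      filter_upwards [h.isOpen_source.mem_nhds hu] with v hv
      exact partialDeriv_clm_comp ((h.contDiffAt hv).differentiableAt (by simp)) f j
    rw [← partialDeriv_clm_comp ((contDiffAt_partialDeriv hψ j).differentiableAt (by simp)) f i]
    exact congrArg (fun T : EuclideanSpace ℝ (Fin d) →L[ℝ] ℝ => T (EuclideanSpace.single i 1))
      h1.fderiv_eq
  -- The Christoffel term is `f` of the tangential part of `∂_i ∂_j ψ`, so the Hessian of a linear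
  -- function is `f` of the normal part, that is, of the second fundamental form.
  have hnormal : ∀ i j, partialDeriv i (partialDeriv j (f ∘ ψ)) u
      - ∑ k, christoffel ψ k i j u * partialDeriv k (f ∘ ψ) u =
      f (dproj (ψ u) (partialDeriv i ψ u) (partialDeriv j ψ u)) := by
    intro i j
    have hs : ∑ k, christoffel ψ k i j u * partialDeriv k (f ∘ ψ) u =
        f (proj (ψ u) (partialDeriv i (partialDeriv j ψ) u)) := by
      rw [D.proj_eq_sum h hu, map_sum]
      refine Finset.sum_congr rfl fun k _ => ?_
      rw [christoffel_eq hψ, partialDeriv_clm_comp (hψ.differentiableAt (by simp)), map_smul,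
        smul_eq_mul]
    have h1 : HasDerivAt (fun t : ℝ => ψ (u + t • EuclideanSpace.single i 1))
        (partialDeriv i ψ u) 0 := hasDerivAt_line (hψ.differentiableAt (by simp)) _
    have h2 : HasDerivAt (fun t : ℝ => partialDeriv j ψ (u + t • EuclideanSpace.single i 1))
        (partialDeriv i (partialDeriv j ψ) u) 0 :=
      hasDerivAt_line ((contDiffAt_partialDeriv hψ j).differentiableAt (by simp)) _
    have h3 := D.hasDerivAt _ _ _ _ h1 h2
    have h4 : (fun t : ℝ => proj (ψ (u + t • EuclideanSpace.single i 1))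
        (partialDeriv j ψ (u + t • EuclideanSpace.single i 1))) =ᶠ[𝓝 0]
        fun t : ℝ => partialDeriv j ψ (u + t • EuclideanSpace.single i 1) := by
      filter_upwards [eventually_line_mem h.isOpen_source hu (EuclideanSpace.single i 1)]
        with t ht using D.proj_fderiv h ht _
    have h5 := h2.unique (h3.congr_of_eventuallyEq h4.symm)
    simp only [zero_smul, add_zero] at h5
    rw [hsecond, hs, ← map_sub]
    congr 1
    nth_rewrite 1 [h5]
    simp
  let b := stdOrthonormalBasis ℝ E
  have htr : ∀ k, proj (ψ u) (b k) = ∑ i, ∑ j, ((metricMatrix ψ u)⁻¹ i j *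
      inner ℝ (b k) (partialDeriv j ψ u)) • partialDeriv i ψ u := by
    intro k
    rw [D.proj_eq_sum h hu]
    simp only [Finset.sum_smul]
  have hmin := D.minimal _ (h.mem hu) b
  -- The contraction with `g^{ij}` is the trace over the tangent space: expanding `proj (b k)` in
  -- the coordinate frame and summing over `k` reassembles each `∂_j ψ` from the orthonormal basis.
  have : ∑ i, ∑ j, (metricMatrix ψ u)⁻¹ i j •
      dproj (ψ u) (partialDeriv i ψ u) (partialDeriv j ψ u) = -(d : ℝ) • ψ u := by
    rw [← hmin]
    simp only [htr, map_sum, map_smul, LinearMap.sum_apply, LinearMap.smul_apply]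
    symm
    rw [Finset.sum_comm]
    refine Finset.sum_congr rfl fun i _ => ?_
    rw [Finset.sum_comm]
    refine Finset.sum_congr rfl fun j _ => ?_
    simp only [mul_smul, ← map_smul]
    rw [← map_sum, ← Finset.smul_sum, b.sum_repr']
  unfold laplaceBeltrami
  simp only [hnormal]
  have h6 := congrArg f this
  simpa [map_sum, map_smul] using h6

end MinimalTangentData

end Laplacian

/-! ### Focal maps of a symmetric involution on a minimal submanifold. -/

section FocalMaps

variable {E : Type*} [NormedAddCommGroup E] [InnerProductSpace ℝ E]

/-- The linear map `(1 + ε B) / √2`. -/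
noncomputable def focalLin (B : E →ₗ[ℝ] E) (ε : ℝ) : E →ₗ[ℝ] E :=
  (1 / √2 : ℝ) • (LinearMap.id + ε • B)

theorem focalLin_apply (B : E →ₗ[ℝ] E) (ε : ℝ) (x : E) :
    focalLin B ε x = (1 / √2 : ℝ) • (x + ε • B x) := rfl

theorem one_div_sqrt_two_mul_self : (1 / √2 : ℝ) * (1 / √2) = 1 / 2 := by
  rw [div_mul_div_comm, Real.mul_self_sqrt (by norm_num), one_mul]

section Involution

variable {B : E →ₗ[ℝ] E} {ε : ℝ}

theorem map_focalLin (hBB : ∀ x, B (B x) = x) (hε : ε * ε = 1) (x : E) :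
    B (focalLin B ε x) = ε • focalLin B ε x := by
  simp only [focalLin_apply, map_smul, map_add, hBB, smul_add, smul_smul]
  rw [show ε * (1 / √2 * ε) = 1 / √2 by linear_combination (1 / √2) * hε]
  rw [add_comm, mul_comm ε]

/-- The operator is symmetric with square `1 + ε B`. Hence it preserves norms where `⟨B x, x⟩ = 0`.
-/
theorem inner_focalLin (hB : B.IsSymmetric) (hBB : ∀ x, B (B x) = x) (hε : ε * ε = 1) (x v : E) :
    inner ℝ (focalLin B ε x) (focalLin B ε v) = inner ℝ x v + ε * inner ℝ (B x) v := by
  have h1 : inner ℝ (B x) (B v) = inner ℝ x v := by rw [hB, hBB]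
  have h2 : inner ℝ x (B v) = inner ℝ (B x) v := (hB x v).symm
  simp only [focalLin_apply, inner_smul_left, inner_smul_right, inner_add_left, inner_add_right,
    h1, h2, RCLike.conj_to_real]
  have h3 := one_div_sqrt_two_mul_self
  linear_combination
    (inner ℝ x v + 2 * ε * inner ℝ (B x) v + ε * ε * inner ℝ x v) * h3 + (1 / 2) * inner ℝ x v * hε

/-- Sufficient conditions for the focal map `(1 + ε B) / √2` of a symmetric involution `B` to be a
submersive eigenmap from a minimal submanifold of the unit sphere onto the unit sphere of an
eigenspace of `B`. -/
theorem MinimalTangentData.isSubmersiveEigenmapOnto [FiniteDimensional ℝ E] {M : Set E} {d l : ℕ}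
    {proj : E → E →ₗ[ℝ] E} {dproj : E → E →ₗ[ℝ] E →ₗ[ℝ] E}
    (D : MinimalTangentData M d proj dproj) (hB : B.IsSymmetric) (hBB : ∀ x, B (B x) = x)
    (hε : ε * ε = 1) (hl : Module.finrank ℝ (Module.End.eigenspace B ε) = l)
    (hnorm : ∀ x ∈ M, ‖x‖ = 1) (hBx : ∀ x ∈ M, inner ℝ (B x) x = 0)
    (htan : ∀ x ∈ M, ∀ v, proj x v = v → inner ℝ x v = 0 ∧ inner ℝ (B x) v = 0)
    (hsurj : ∀ y, ‖y‖ = 1 → B y = ε • y → ∃ x ∈ M, focalLin B ε x = y)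
    (hsubm : ∀ x ∈ M, ∀ w, B w = ε • w → inner ℝ (focalLin B ε x) w = 0 →
      ∃ v, proj x v = v ∧ focalLin B ε v = w) :
    IsSubmersiveEigenmapOnto M d l (focalLin B ε) {y | ‖y‖ = 1 ∧ B y = ε • y} d := by
  have himage : focalLin B ε '' M = {y | ‖y‖ = 1 ∧ B y = ε • y} := by
    ext y
    constructor
    · rintro ⟨x, hx, rfl⟩
      refine ⟨?_, map_focalLin hBB hε x⟩
      have h1 := inner_focalLin hB hBB hε x x
      rw [hBx x hx, real_inner_self_eq_norm_sq, real_inner_self_eq_norm_sq, hnorm x hx] at h1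
      nlinarith [norm_nonneg (focalLin B ε x)]
    · rintro ⟨h1, h2⟩
      exact hsurj y h1 h2
  refine ⟨?_, himage, ?_⟩
  · let e : EuclideanSpace ℝ (Fin l) ≃ₗᵢ[ℝ] Module.End.eigenspace B ε :=
      ((stdOrthonormalBasis ℝ _).reindex (finCongr hl)).repr.symm
    refine ⟨(Module.End.eigenspace B ε).subtypeₗᵢ.comp e.toLinearIsometry, ?_⟩
    ext y
    constructor
    · rintro ⟨w, hw, rfl⟩
      refine ⟨?_, Module.End.mem_eigenspace_iff.1 (e w).2⟩
      rw [LinearIsometry.norm_map]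
      simpa using hw
    · rintro ⟨h1, h2⟩
      refine ⟨e.symm ⟨y, Module.End.mem_eigenspace_iff.2 h2⟩, ?_, by simp⟩
      simpa using h1
  · intro J hJ
    -- Only the image of the unit sphere under `J` is given; homogeneity identifies the whole range
    -- of `J` with the `ε`-eigenspace.
    have hJB : ∀ w, B (J w) = ε • J w := by
      intro w
      by_cases hw : w = 0
      · simp [hw]
      have hn : ‖w‖ ≠ 0 := norm_ne_zero_iff.2 hw
      have h1 : J (‖w‖⁻¹ • w) ∈ {y | ‖y‖ = 1 ∧ B y = ε • y} := by
        rw [← hJ]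
        refine ⟨_, ?_, rfl⟩
        simp [norm_smul, hn]
      have h2 := congrArg (‖w‖ • ·) h1.2
      simp only [map_smul] at h2
      rwa [smul_comm ε, smul_smul, smul_smul, mul_inv_cancel₀ hn, one_smul, one_smul] at h2
    have hrange : ∀ y, B y = ε • y → ∃ w, J w = y := by
      intro y hy
      by_cases h0 : y = 0
      · exact ⟨0, by simp [h0]⟩
      have hn : ‖y‖ ≠ 0 := norm_ne_zero_iff.2 h0
      have h1 : ‖y‖⁻¹ • y ∈ J '' Metric.sphere 0 1 := by
        rw [hJ]
        refine ⟨by simp [norm_smul, hn], ?_⟩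
        rw [map_smul, hy, smul_comm]
      obtain ⟨w, -, hw⟩ := h1
      exact ⟨‖y‖ • w, by rw [map_smul, hw, smul_smul, mul_inv_cancel₀ hn, one_smul]⟩
    -- On its range `J` is inverted by its adjoint, so the components of `Φ` are linear functions on
    -- `E`.
    let Φ : E →L[ℝ] EuclideanSpace ℝ (Fin l) :=
      (ContinuousLinearMap.adjoint J.toContinuousLinearMap) ∘L (focalLin B ε).toContinuousLinearMap
    have hadj : ∀ w, ContinuousLinearMap.adjoint J.toContinuousLinearMap (J w) = w := by
      intro w
      refine ext_inner_right ℝ fun v => ?_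
      rw [ContinuousLinearMap.adjoint_inner_left]
      exact J.inner_map_map w v
    have hJΦ : ∀ x, J (Φ x) = focalLin B ε x := by
      intro x
      obtain ⟨w, hw⟩ := hrange _ (map_focalLin hBB hε x)
      have : Φ x = w := by
        rw [← hadj w, hw]
        rfl
      rw [this, hw]
    have hmaps : ∀ x ∈ M, ‖Φ x‖ = 1 := by
      intro x hx
      have h1 : focalLin B ε x ∈ {y | ‖y‖ = 1 ∧ B y = ε • y} := himage ▸ ⟨x, hx, rfl⟩
      rw [← J.norm_map, hJΦ]
      exact h1.1
    refine ⟨Φ, fun x _ => hJΦ x, ⟨fun x hx => by simpa using hmaps x hx, fun k => ⟨?_, ?_, ?_⟩⟩, ?_⟩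
    · intro U ψ h
      have hk : ContDiff ℝ ∞ fun x => Φ x k :=
        ((EuclideanSpace.proj k : _ →L[ℝ] ℝ) ∘L Φ).contDiff
      exact hk.comp_contDiffOn h.contDiffOn
    -- Surjectivity provides a point of `M` where the `k`-th component equals `1`.
    · have h1 : J (EuclideanSpace.single k 1) ∈ focalLin B ε '' M := by
        rw [himage, ← hJ]
        exact ⟨_, by simp, rfl⟩
      obtain ⟨x, hx, hxk⟩ := h1
      refine ⟨x, hx, ?_⟩
      rw [← hJΦ] at hxk
      simp [J.injective hxk]
    · intro U ψ h u hu
      exact D.laplaceBeltrami_clm h hu ((EuclideanSpace.proj k : _ →L[ℝ] ℝ) ∘L Φ)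
    · intro U ψ h u hu
      have hψ : DifferentiableAt ℝ ψ u := (h.contDiffAt hu).differentiableAt (by simp)
      have hM := h.mem hu
      have hfd : ∀ v, fderiv ℝ (Φ ∘ ψ) u v = Φ (fderiv ℝ ψ u v) := by
        intro v
        rw [fderiv_comp u Φ.differentiableAt hψ]
        simp
      ext w
      constructor
      · rintro ⟨v, rfl⟩
        have h1 := htan _ hM _ (D.proj_fderiv h hu v)
        rw [Set.mem_ofPred_eq, hfd, ← J.inner_map_map, hJΦ, hJΦ, inner_focalLin hB hBB hε, h1.1,
          h1.2]
        simp
      · intro hw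
        obtain ⟨v, hv, hvw⟩ := hsubm _ hM (J w) (hJB w) (by
          rw [← hJΦ, J.inner_map_map]; exact hw)
        have h1 : v ∈ LinearMap.range (fderiv ℝ ψ u).toLinearMap := by
          rw [D.range_fderiv h hu]
          exact ⟨v, hv⟩
        obtain ⟨v', rfl⟩ := h1
        refine ⟨v', ?_⟩
        rw [hfd]
        refine J.injective ?_
        rw [hJΦ]
        exact hvw

end Involution

end FocalMaps

/-! ### Algebra and traces of Clifford families. -/

section CliffordFamilies

variable {E : Type*} [NormedAddCommGroup E] [InnerProductSpace ℝ E]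

/-- A finite family of symmetric operators with `A α A β + A β A α = 2 δ_{αβ}`. -/
structure CliffordFamily {ι : Type*} [DecidableEq ι] (A : ι → E →ₗ[ℝ] E) : Prop where
  symm : ∀ α, (A α).IsSymmetric
  anticomm : ∀ α β x, A α (A β x) + A β (A α x) = if α = β then (2 : ℝ) • x else 0

namespace CliffordFamily

variable {ι : Type*} [DecidableEq ι] {A : ι → E →ₗ[ℝ] E}

theorem apply_apply (h : CliffordFamily A) (α : ι) (x : E) : A α (A α x) = x := by
  have := h.anticomm α α x
  rw [if_pos rfl, ← two_smul ℝ] at this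
  exact smul_right_injective E (two_ne_zero' ℝ) this

theorem apply_apply_of_ne (h : CliffordFamily A) {α β : ι} (hαβ : α ≠ β) (x : E) :
    A α (A β x) = -A β (A α x) := by
  have := h.anticomm α β x
  rw [if_neg hαβ] at this
  exact eq_neg_of_add_eq_zero_left this

theorem inner_map_map (h : CliffordFamily A) (α : ι) (x y : E) :
    inner ℝ (A α x) (A α y) = inner ℝ x y := by
  rw [h.symm, h.apply_apply]

theorem inner_map_map_eq_zero (h : CliffordFamily A) {α β : ι} (hαβ : α ≠ β) (x : E) :
    inner ℝ (A α x) (A β x) = 0 := by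
  have h1 : inner ℝ (A α x) (A β x) = -inner ℝ (A β x) (A α x) := by
    rw [h.symm, h.apply_apply_of_ne hαβ, inner_neg_right, h.symm β]
  rw [real_inner_comm (A α x)] at h1
  linarith

theorem inner_map_self_map (h : CliffordFamily A) (α β : ι) (x : E) :
    inner ℝ (A α x) (A β x) = if α = β then ‖x‖ ^ 2 else 0 := by
  split_ifs with hαβ
  · rw [hαβ, h.inner_map_map, real_inner_self_eq_norm_sq]
  · exact h.inner_map_map_eq_zero hαβ x

theorem inner_map_conj (h : CliffordFamily A) (α β : ι) (x : E) :
    inner ℝ (A β x) (A α (A β x)) = (if α = β then 1 else -1) * inner ℝ (A α x) x := by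
  split_ifs with hαβ
  · rw [hαβ, h.apply_apply, one_mul]
  · rw [h.apply_apply_of_ne hαβ, inner_neg_right, h.inner_map_map, real_inner_comm, neg_one_mul]

theorem comp {κ : Type*} [DecidableEq κ] (h : CliffordFamily A) {f : κ → ι}
    (hf : Function.Injective f) : CliffordFamily fun k => A (f k) where
  symm k := h.symm (f k)
  anticomm k k' x := by simp [h.anticomm, hf.eq_iff]

section Trace

/-- Conjugation by the involution `A β` sends `A α` to `-A α` but preserves the trace. -/
theorem trace_eq_zero (h : CliffordFamily A) {α β : ι} (hαβ : α ≠ β) :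
    LinearMap.trace ℝ E (A α) = 0 := by
  have h1 : A α = A β * (A β * A α) := by
    ext x; simp [h.apply_apply]
  have h2 : (A β * A α) * A β = -A α := by
    ext x
    simp only [Module.End.mul_apply, LinearMap.neg_apply]
    rw [h.apply_apply_of_ne hαβ, map_neg, h.apply_apply]
  have h3 : LinearMap.trace ℝ E (A α) = -LinearMap.trace ℝ E (A α) := by
    conv_lhs => rw [h1, LinearMap.trace_mul_comm, h2, map_neg]
  linarith

theorem trace_mul [FiniteDimensional ℝ E] (h : CliffordFamily A) (α β : ι) :
    LinearMap.trace ℝ E (A α * A β) = if α = β then (Module.finrank ℝ E : ℝ) else 0 := by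
  split_ifs with hαβ
  · have : A α * A β = 1 := by
      subst hαβ
      ext x; simp [h.apply_apply]
    rw [this, LinearMap.trace_one]
  · have h1 : A α * A β = -(A β * A α) := by
      ext x
      exact h.apply_apply_of_ne hαβ x
    have h2 : LinearMap.trace ℝ E (A α * A β) = -LinearMap.trace ℝ E (A α * A β) := by
      conv_lhs => rw [h1, map_neg, LinearMap.trace_mul_comm]
    linarith

end Trace

end CliffordFamily

theorem finrank_range_of_trace_eq [FiniteDimensional ℝ E] {T : E →ₗ[ℝ] E}
    (hT : ∀ x, T (T x) = T x) {d : ℕ} (hd : LinearMap.trace ℝ E T = d) :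
    Module.finrank ℝ (LinearMap.range T) = d := by
  have h : LinearMap.IsProj (LinearMap.range T) T :=
    ⟨fun x => ⟨x, rfl⟩, by rintro _ ⟨x, rfl⟩; exact hT x⟩
  have h1 := h.trace
  rw [hd] at h1
  exact_mod_cast h1.symm

/-- The eigenspaces `±1` of a trace-free involution are half-dimensional. -/
theorem finrank_eigenspace_of_involution [FiniteDimensional ℝ E] {B : E →ₗ[ℝ] E}
    (hBB : ∀ x, B (B x) = x) (htr : LinearMap.trace ℝ E B = 0) {ε : ℝ} (hε : ε * ε = 1) {l : ℕ}
    (hl : Module.finrank ℝ E = 2 * l) : Module.finrank ℝ (Module.End.eigenspace B ε) = l := by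
  have h : LinearMap.IsProj (Module.End.eigenspace B ε)
      ((1 / 2 : ℝ) • (LinearMap.id + ε • B)) := by
    refine ⟨fun x => ?_, fun x hx => ?_⟩
    · rw [Module.End.mem_eigenspace_iff]
      simp only [LinearMap.smul_apply, LinearMap.add_apply, LinearMap.id_apply, map_smul, map_add,
        hBB, smul_add, smul_smul]
      rw [show ε * (1 / 2 * ε) = 1 / 2 by linear_combination (1 / 2) * hε, add_comm, mul_comm ε]
    · rw [Module.End.mem_eigenspace_iff] at hx
      simp only [LinearMap.smul_apply, LinearMap.add_apply, LinearMap.id_apply, hx, smul_smul, hε]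
      rw [one_smul, ← two_smul ℝ, smul_smul]
      norm_num
  have h1 := h.trace
  rw [map_smul, map_add, map_smul, htr, LinearMap.trace_id, hl] at h1
  have h2 : (l : ℝ) = Module.finrank ℝ (Module.End.eigenspace B ε) := by
    rw [← h1]; push_cast; simp
  exact_mod_cast h2.symm

/-- The operator `v ↦ ⟨a, v⟩ b`. -/
noncomputable def outer (a b : E) : E →ₗ[ℝ] E := (innerₛₗ ℝ a).smulRight b

@[simp]
theorem outer_apply (a b v : E) : outer a b v = inner ℝ a v • b := rfl

theorem trace_outer [FiniteDimensional ℝ E] (a b : E) :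
    LinearMap.trace ℝ E (outer a b) = inner ℝ a b := by
  rw [LinearMap.trace_eq_sum_inner _ (stdOrthonormalBasis ℝ E),
    ← (stdOrthonormalBasis ℝ E).sum_inner_mul_inner a b]
  simp [inner_smul_right]

/-- This and `sum_inner_map_self` evaluate the contractions that occur in the trace of the second
fundamental form. -/
theorem sum_inner_smul_map {κ : Type*} [Fintype κ] (b : OrthonormalBasis κ ℝ E) (F : E →ₗ[ℝ] E)
    (c : E) : ∑ k, inner ℝ c (b k) • F (b k) = F c := by
  conv_rhs => rw [← b.sum_repr' c, map_sum]
  simp [real_inner_comm]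

theorem sum_inner_map_self {κ : Type*} [Fintype κ] (b : OrthonormalBasis κ ℝ E) (F : E →ₗ[ℝ] E) :
    ∑ k, inner ℝ (F (b k)) (b k) = LinearMap.trace ℝ E F := by
  rw [LinearMap.trace_eq_sum_inner _ b]
  simp [real_inner_comm]

theorem _root_.HasDerivAt.linearMap_apply [FiniteDimensional ℝ E] {c : ℝ → E} {v : E} {t : ℝ}
    (hc : HasDerivAt c v t) (T : E →ₗ[ℝ] E) : HasDerivAt (fun s => T (c s)) (T v) t :=
  (LinearMap.toContinuousLinearMap T).hasFDerivAt.comp_hasDerivAt t hc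

theorem inner_eq_zero_of_eventually_norm_eq_one {c : ℝ → E} {v : E}
    (hc : ∀ᶠ t in 𝓝 0, ‖c t‖ = 1) (hv : HasDerivAt c v 0) : inner ℝ (c 0) v = 0 := by
  have h1 := hv.inner ℝ hv
  have h2 : (fun t => inner ℝ (c t) (c t)) =ᶠ[𝓝 0] fun _ => (1 : ℝ) := by
    filter_upwards [hc] with t ht
    rw [real_inner_self_eq_norm_sq, ht, one_pow]
  have h3 := (h1.congr_of_eventuallyEq h2.symm).unique (hasDerivAt_const _ _)
  rw [real_inner_comm (c 0)] at h3
  linarith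

theorem hasDerivAt_inner_map_self [FiniteDimensional ℝ E] {T : E →ₗ[ℝ] E} (hT : T.IsSymmetric)
    {c : ℝ → E} {v : E} {t : ℝ} (hc : HasDerivAt c v t) :
    HasDerivAt (fun s => inner ℝ (T (c s)) (c s)) (2 * inner ℝ (T (c t)) v) t := by
  refine ((hc.linearMap_apply T).inner ℝ hc).congr_deriv ?_
  rw [hT v, real_inner_comm]
  ring

end CliffordFamilies

/-! ### Common zero sets (the sets `M_i`): tangent projection, minimality, smoothness. -/

section ZeroSet

variable {E : Type*} [NormedAddCommGroup E] [InnerProductSpace ℝ E]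
  {ι : Type*}

/-- The common zero set `{x ∈ S : ⟨A_α x, x⟩ = 0 for all α}` in the unit sphere. -/
def zeroSet (A : ι → E →ₗ[ℝ] E) : Set E := {x | ‖x‖ = 1 ∧ ∀ α, inner ℝ (A α x) x = 0}

theorem inner_map_of_mem_zeroSet {A : ι → E →ₗ[ℝ] E} {x : E} (hx : x ∈ zeroSet A) (α : ι) :
    inner ℝ x (A α x) = 0 := by
  rw [real_inner_comm, hx.2]

variable [Fintype ι]

/-- The orthogonal projection onto the tangent space of `zeroSet A` at `x`. -/
noncomputable def zeroSetProj (A : ι → E →ₗ[ℝ] E) (x : E) : E →ₗ[ℝ] E :=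
  LinearMap.id - outer x x - ∑ α, outer (A α x) (A α x)

theorem zeroSetProj_apply (A : ι → E →ₗ[ℝ] E) (x v : E) :
    zeroSetProj A x v = v - inner ℝ x v • x - ∑ α, inner ℝ (A α x) v • A α x := by
  simp [zeroSetProj, LinearMap.sum_apply]

/-- The derivative of `zeroSetProj A`. -/
noncomputable def zeroSetDProj (A : ι → E →ₗ[ℝ] E) (x : E) : E →ₗ[ℝ] E →ₗ[ℝ] E :=
  LinearMap.mk₂ ℝ
    (fun v w => -(inner ℝ x w • v) - inner ℝ v w • x
      - ∑ α, (inner ℝ (A α x) w • A α v + inner ℝ (A α v) w • A α x))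
    (fun v v' w => by
      simp only [map_add, inner_add_left, add_smul, smul_add, Finset.sum_add_distrib]; abel)
    (fun c v w => by
      simp only [map_smul, inner_smul_left, RCLike.conj_to_real, mul_smul, smul_comm _ c,
        ← smul_add, ← Finset.smul_sum, ← smul_neg, ← smul_sub])
    (fun v w w' => by
      simp only [inner_add_right, add_smul, Finset.sum_add_distrib]; abel)
    (fun c v w => by
      simp only [inner_smul_right, mul_smul, ← smul_add, ← Finset.smul_sum, ← smul_neg,
        ← smul_sub])

theorem zeroSetDProj_apply (A : ι → E →ₗ[ℝ] E) (x v w : E) :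
    zeroSetDProj A x v w = -(inner ℝ x w • v) - inner ℝ v w • x
      - ∑ α, (inner ℝ (A α x) w • A α v + inner ℝ (A α v) w • A α x) := rfl

variable {A : ι → E →ₗ[ℝ] E}

theorem zeroSetProj_isSymmetric (A : ι → E →ₗ[ℝ] E) (x : E) : (zeroSetProj A x).IsSymmetric := by
  intro v w
  simp only [zeroSetProj_apply, inner_sub_left, inner_sub_right, sum_inner, inner_sum,
    inner_smul_left, inner_smul_right, RCLike.conj_to_real, real_inner_comm v]
  simp only [mul_comm]

variable [DecidableEq ι]

theorem zeroSetProj_eq_self_iff (hA : CliffordFamily A) {x : E} (hx : x ∈ zeroSet A) (v : E) :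
    zeroSetProj A x v = v ↔ inner ℝ x v = 0 ∧ ∀ α, inner ℝ (A α x) v = 0 := by
  constructor
  · intro h
    rw [zeroSetProj_apply] at h
    have h0 : inner ℝ x v • x + ∑ α, inner ℝ (A α x) v • A α x = 0 := by
      rw [← sub_eq_zero] at h
      rw [← neg_eq_zero, ← h]; abel
    constructor
    · have h1 := congrArg (inner ℝ x) h0
      simpa [inner_add_right, inner_sum, inner_smul_right, hx.1,
        inner_map_of_mem_zeroSet hx] using h1
    · intro β
      have h1 := congrArg (inner ℝ (A β x)) h0
      simpa [inner_add_right, inner_sum, inner_smul_right, hx.1, hx.2,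
        hA.inner_map_self_map] using h1
  · rintro ⟨h1, h2⟩
    simp [zeroSetProj_apply, h1, h2]

theorem inner_zeroSetProj (hA : CliffordFamily A) {x : E} (hx : x ∈ zeroSet A) (v : E) :
    inner ℝ x (zeroSetProj A x v) = 0 ∧ ∀ α, inner ℝ (A α x) (zeroSetProj A x v) = 0 := by
  constructor
  · simp [zeroSetProj_apply, inner_sub_right, inner_sum, inner_smul_right,
      hx.1, inner_map_of_mem_zeroSet hx]
  · intro α
    simp [zeroSetProj_apply, inner_sub_right, inner_sum, inner_smul_right, hx.1, hx.2,
      hA.inner_map_self_map]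

theorem zeroSetProj_proj (hA : CliffordFamily A) {x : E} (hx : x ∈ zeroSet A) (v : E) :
    zeroSetProj A x (zeroSetProj A x v) = zeroSetProj A x v :=
  (zeroSetProj_eq_self_iff hA hx _).2 (inner_zeroSetProj hA hx v)

variable [FiniteDimensional ℝ E]

theorem finrank_range_zeroSetProj (hA : CliffordFamily A) {x : E} (hx : x ∈ zeroSet A) {d : ℕ}
    (hd : Module.finrank ℝ E = d + 1 + Fintype.card ι) :
    Module.finrank ℝ (LinearMap.range (zeroSetProj A x)) = d := by
  refine finrank_range_of_trace_eq (zeroSetProj_proj hA hx) ?_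
  simp only [zeroSetProj, map_sub, LinearMap.trace_id, map_sum, trace_outer,
    hA.inner_map_map, real_inner_self_eq_norm_sq, hx.1, hd]
  simp only [Finset.sum_const, Finset.card_univ]
  push_cast
  simp only [one_pow, nsmul_eq_mul, mul_one]
  ring

/-- Up to sign this is the mean curvature in the normal direction `A α x`. Each normal vector `A β
x` contributes `⟨A β x, A α (A β x)⟩ = ± ⟨A α x, x⟩ = 0`. -/
theorem trace_mul_zeroSetProj (hA : CliffordFamily A) (htr : ∀ α, LinearMap.trace ℝ E (A α) = 0)
    {x : E} (hx : x ∈ zeroSet A) (α : ι) :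
    LinearMap.trace ℝ E (A α * zeroSetProj A x) = 0 := by
  have hout : ∀ a b, A α * outer a b = outer a (A α b) := by
    intro a b; ext v; simp
  simp only [zeroSetProj, mul_sub, Finset.mul_sum, map_sub, map_sum, hout, trace_outer,
    hA.inner_map_conj, hx.2, mul_zero]
  rw [show A α * LinearMap.id = A α from mul_one _, htr, real_inner_comm, hx.2]
  simp

theorem zeroSet_minimalTangentData (hA : CliffordFamily A)
    (htr : ∀ α, LinearMap.trace ℝ E (A α) = 0) {d : ℕ}
    (hd : Module.finrank ℝ E = d + 1 + Fintype.card ι) :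
    MinimalTangentData (zeroSet A) d (zeroSetProj A) (zeroSetDProj A) where
  symm x _ := zeroSetProj_isSymmetric A x
  finrank_range x hx := finrank_range_zeroSetProj hA hx hd
  tangent c v hc hv := by
    rw [zeroSetProj_eq_self_iff hA hc.self_of_nhds]
    refine ⟨inner_eq_zero_of_eventually_norm_eq_one (hc.mono fun t ht => ht.1) hv, fun α => ?_⟩
    have h1 := hasDerivAt_inner_map_self (hA.symm α) hv
    have h2 : (fun t => inner ℝ (A α (c t)) (c t)) =ᶠ[𝓝 0] fun _ => (0 : ℝ) :=
      hc.mono fun t ht => ht.2 α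
    have h3 := (h1.congr_of_eventuallyEq h2.symm).unique (hasDerivAt_const _ _)
    linarith
  hasDerivAt y w y' w' hy hw := by
    have h1 := (hw.sub ((hy.inner ℝ hw).smul hy)).sub
      (HasDerivAt.fun_sum (u := Finset.univ) fun α _ =>
        ((hy.linearMap_apply (A α)).inner ℝ hw).smul (hy.linearMap_apply (A α)))
    simp only [zeroSetProj_apply]
    refine h1.congr_deriv ?_
    simp only [zeroSetDProj_apply, add_smul, Finset.sum_add_distrib]
    abel
  minimal x hx κ _ b := by
    have hx0 : zeroSetProj A x x = 0 := by
      simp [zeroSetProj_apply, hx.1, hx.2]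
    have hAx0 : ∀ α, zeroSetProj A x (A α x) = 0 := fun α => by
      simp [zeroSetProj_apply, hA.inner_map_self_map, hx.1, inner_map_of_mem_zeroSet hx]
    have h1 : ∑ k, inner ℝ x (b k) • zeroSetProj A x (b k) = 0 := by
      rw [sum_inner_smul_map, hx0]
    have h2 : ∑ k, inner ℝ (zeroSetProj A x (b k)) (b k) = (d : ℝ) := by
      rw [sum_inner_map_self, ← finrank_range_zeroSetProj hA hx hd]
      have h : LinearMap.IsProj (LinearMap.range (zeroSetProj A x)) (zeroSetProj A x) :=
        ⟨fun x => ⟨x, rfl⟩, by rintro _ ⟨y, rfl⟩; exact zeroSetProj_proj hA hx y⟩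
      exact h.trace
    have h3 : ∀ α, ∑ k, inner ℝ (A α x) (b k) • A α (zeroSetProj A x (b k)) = 0 := by
      intro α
      have := sum_inner_smul_map b (A α * zeroSetProj A x) (A α x)
      simpa [hAx0] using this
    have h4 : ∀ α, ∑ k, inner ℝ (A α (zeroSetProj A x (b k))) (b k) = 0 := by
      intro α
      have := sum_inner_map_self b (A α * zeroSetProj A x)
      rwa [trace_mul_zeroSetProj hA htr hx] at this
    simp only [zeroSetDProj_apply, Finset.sum_sub_distrib, Finset.sum_neg_distrib, h1,
      ← Finset.sum_smul, h2]
    rw [Finset.sum_comm]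
    simp only [Finset.sum_add_distrib, h3, ← Finset.sum_smul, h4]
    simp

theorem zeroSet_isEmbeddedSubmanifold (hA : CliffordFamily A) {d : ℕ}
    (hd : Module.finrank ℝ E = d + 1 + Fintype.card ι) :
    IsEmbeddedSubmanifold (zeroSet A) d := by
  intro x hx
  -- The tangential part of `z - x`, with half the defining functions as coordinates in the normal
  -- frame `x`, `A α x`. The factor `1 / 2` cancels the `2` from differentiating quadratic forms, so
  -- the differential at `x` is the identity.
  set Θ : E → E := fun z => zeroSetProj A x (z - x) + (1 / 2 : ℝ) • ((inner ℝ z z - 1) • x +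
    ∑ α, inner ℝ (A α z) z • A α x) with hΘ
  have hAs : ∀ α, ContDiff ℝ ∞ fun z => A α z := fun α =>
    (LinearMap.toContinuousLinearMap (A α)).contDiff
  have hs : ContDiff ℝ ∞ Θ := by
    have h1 : ContDiff ℝ ∞ fun z => zeroSetProj A x (z - x) :=
      (LinearMap.toContinuousLinearMap (zeroSetProj A x)).contDiff.comp
        (contDiff_id.sub contDiff_const)
    refine h1.add (contDiff_const.smul (ContDiff.add ?_ (ContDiff.sum fun α _ => ?_)))
    · exact ((contDiff_id.inner ℝ contDiff_id).sub contDiff_const).smul contDiff_const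
    · exact ((hAs α).inner ℝ contDiff_id).smul contDiff_const
  have hder : HasFDerivAt Θ (ContinuousLinearMap.id ℝ E) x := by
    have hd := hs.differentiable (by simp) x
    refine hd.hasFDerivAt.congr_fderiv ?_
    ext v
    have hline := hasDerivAt_add_smul x v
    refine (hasDerivAt_line hd v).unique ?_
    have h1 := ((hline.sub_const x).linearMap_apply (zeroSetProj A x)).add
      (((((hline.inner ℝ hline).sub_const 1).smul_const x).add
        (HasDerivAt.fun_sum (u := Finset.univ) fun α _ =>
          (hasDerivAt_inner_map_self (hA.symm α) hline).smul_const (A α x))).const_smul (1 / 2 : ℝ))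
    refine h1.congr_deriv ?_
    simp only [zero_smul, add_zero, ContinuousLinearMap.id_apply, zeroSetProj_apply, mul_smul,
      ← Finset.smul_sum, real_inner_comm x v, ← two_smul ℝ, smul_add]
    module
  refine exists_isLocalParam_of_straightening hx isOpen_univ (Set.mem_univ x) hs.contDiffOn hder
    (finrank_range_zeroSetProj hA hx hd) (Eventually.of_forall fun z => ?_)
  have hmem : Θ z ∈ LinearMap.range (zeroSetProj A x) ↔ zeroSetProj A x (Θ z) = Θ z := by
    constructor
    · rintro ⟨y, hy⟩
      rw [← hy, zeroSetProj_proj hA hx]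
    · exact fun h => ⟨_, h⟩
  have h0 : inner ℝ x (Θ z) = 1 / 2 * (inner ℝ z z - 1) := by
    simp only [hΘ, inner_add_right, (inner_zeroSetProj hA hx _).1, inner_smul_right, inner_sum,
      real_inner_self_eq_norm_sq x, hx.1, fun α => real_inner_comm (A α x) x, hx.2]
    simp
  have h1 : ∀ β, inner ℝ (A β x) (Θ z) = 1 / 2 * inner ℝ (A β z) z := by
    intro β
    simp only [hΘ, inner_add_right, (inner_zeroSetProj hA hx _).2, inner_smul_right, inner_sum,
      hx.1, hx.2, hA.inner_map_self_map]
    simp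
  rw [hmem, zeroSetProj_eq_self_iff hA hx, h0]
  simp only [h1, zeroSet, Set.mem_ofPred_eq, real_inner_self_eq_norm_sq]
  have hn : ‖z‖ = 1 ↔ 1 / 2 * (‖z‖ ^ 2 - 1) = 0 := by
    constructor
    · intro h; simp [h]
    · intro h; nlinarith [norm_nonneg z]
  rw [hn]
  simp

end ZeroSet

/-! ### Unit sets (the sets `N_i`): tangent projection and minimality. -/

section UnitSet

variable {E : Type*} [NormedAddCommGroup E] [InnerProductSpace ℝ E]
  {ι : Type*} [Fintype ι]

/-- The set `{x ∈ S : ∑_α ⟨A_α x, x⟩² = 1}` in the unit sphere. -/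
def unitSet (A : ι → E →ₗ[ℝ] E) : Set E := {x | ‖x‖ = 1 ∧ ∑ α, inner ℝ (A α x) x ^ 2 = 1}

/-- The linear combination `∑ α, c α • A α`. -/
def lincomb (A : ι → E →ₗ[ℝ] E) (c : ι → ℝ) : E →ₗ[ℝ] E := ∑ α, c α • A α

theorem lincomb_apply (A : ι → E →ₗ[ℝ] E) (c : ι → ℝ) (x : E) :
    lincomb A c x = ∑ α, c α • A α x := by
  simp [lincomb, LinearMap.sum_apply]

/-- The coefficients `⟨A_α x, x⟩`. -/
noncomputable def quadCoeff (A : ι → E →ₗ[ℝ] E) (x : E) : ι → ℝ := fun α => inner ℝ (A α x) x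

variable {A : ι → E →ₗ[ℝ] E}

theorem inner_lincomb_self (A : ι → E →ₗ[ℝ] E) (c : ι → ℝ) (x : E) :
    inner ℝ (lincomb A c x) x = ∑ α, c α * quadCoeff A x α := by
  simp [lincomb_apply, sum_inner, inner_smul_left, quadCoeff]

section Clifford

variable [DecidableEq ι]

theorem CliffordFamily.lincomb_isSymmetric (hA : CliffordFamily A) (c : ι → ℝ) :
    (lincomb A c).IsSymmetric := by
  intro x y
  simp [lincomb_apply, sum_inner, inner_sum, inner_smul_left, inner_smul_right, hA.symm _ x y]

theorem CliffordFamily.lincomb_map (hA : CliffordFamily A) (c : ι → ℝ) (α : ι) (x : E) :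
    lincomb A c (A α x) = (2 * c α) • x - A α (lincomb A c x) := by
  rw [eq_sub_iff_add_eq, lincomb_apply, lincomb_apply, map_sum, ← Finset.sum_add_distrib]
  simp only [map_smul, ← smul_add, hA.anticomm]
  simp [smul_smul, mul_comm]

theorem CliffordFamily.lincomb_lincomb (hA : CliffordFamily A) (c : ι → ℝ) (x : E) :
    lincomb A c (lincomb A c x) = (∑ α, c α ^ 2) • x := by
  -- Moving the outer operator past each `A α` of the inner one reproduces the square with the
  -- opposite sign.
  have h : lincomb A c (lincomb A c x) =
      (2 * ∑ α, c α ^ 2) • x - lincomb A c (lincomb A c x) := by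
    conv_lhs => rw [lincomb_apply A c x, map_sum]
    simp only [map_smul, hA.lincomb_map, smul_sub, Finset.sum_sub_distrib, smul_smul]
    rw [← lincomb_apply A c (lincomb A c x), ← Finset.sum_smul, Finset.mul_sum]
    congr 3
    ext α
    ring
  have h2 : (2 : ℝ) • lincomb A c (lincomb A c x) = (2 : ℝ) • ((∑ α, c α ^ 2) • x) := by
    rw [smul_smul, two_smul]
    nth_rewrite 1 [h]
    abel
  exact smul_right_injective E (two_ne_zero' ℝ) h2

/-- Equality in Cauchy–Schwarz: `x` and its image are unit vectors with inner product `∑ q_α² = 1`.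
-/
theorem lincomb_quadCoeff (hA : CliffordFamily A) {x : E} (hx : x ∈ unitSet A) :
    lincomb A (quadCoeff A x) x = x := by
  have hq : ∑ α, quadCoeff A x α ^ 2 = 1 := hx.2
  have h1 : inner ℝ (lincomb A (quadCoeff A x) x) x = 1 := by
    rw [inner_lincomb_self, ← hq]
    simp only [sq]
  have h2 : inner ℝ (lincomb A (quadCoeff A x) x) (lincomb A (quadCoeff A x) x) = 1 := by
    rw [hA.lincomb_isSymmetric, hA.lincomb_lincomb, hq, one_smul, real_inner_self_eq_norm_sq,
      hx.1, one_pow]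
  rw [← sub_eq_zero, ← inner_self_eq_zero (𝕜 := ℝ)]
  rw [inner_sub_left, inner_sub_right, inner_sub_right, h1, h2, real_inner_comm, h1,
    real_inner_self_eq_norm_sq, hx.1]
  norm_num

/-- Here `c · q = 1`, so `0 ≤ |c - q|² = |q|² - 1`. Conversely `|q|² = ⟨A_q x, x⟩ ≤ ‖A_q x‖ = |q|`
for `A_q = ∑ q_α A_α`, which gives `|q| ≤ 1`. -/
theorem mem_unitSet_of_lincomb (hA : CliffordFamily A) {x : E} (hx : ‖x‖ = 1) {c : ι → ℝ}
    (hc : ∑ α, c α ^ 2 = 1) (hcx : lincomb A c x = x) : x ∈ unitSet A := by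
  refine ⟨hx, ?_⟩
  set q := quadCoeff A x with hq
  change ∑ α, q α ^ 2 = 1
  have h1 : ∑ α, c α * q α = 1 := by
    rw [← inner_lincomb_self, hcx, real_inner_self_eq_norm_sq, hx, one_pow]
  have h2 : ∑ α, (c α - q α) ^ 2 = ∑ α, q α ^ 2 - 1 := by
    have : ∀ α, (c α - q α) ^ 2 = c α ^ 2 - 2 * (c α * q α) + q α ^ 2 := fun α => by ring
    simp only [this, Finset.sum_add_distrib, Finset.sum_sub_distrib, ← Finset.mul_sum, hc, h1]
    ring
  have h3 : 0 ≤ ∑ α, (c α - q α) ^ 2 := Finset.sum_nonneg fun α _ => sq_nonneg _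
  have h4 : ∑ α, q α ^ 2 = inner ℝ (lincomb A q x) x := by
    rw [inner_lincomb_self]
    simp only [sq, hq]
  have h5 : ‖lincomb A q x‖ ^ 2 = ∑ α, q α ^ 2 := by
    rw [← real_inner_self_eq_norm_sq, hA.lincomb_isSymmetric, hA.lincomb_lincomb,
      inner_smul_right, real_inner_self_eq_norm_sq, hx]
    ring
  have h6 := real_inner_le_norm (lincomb A q x) x
  rw [hx, mul_one, ← h4, ← h5] at h6
  have h7 : ‖lincomb A q x‖ ^ 2 ≤ 1 := by
    by_contra hlt
    push Not at hlt
    have : 1 < ‖lincomb A q x‖ := by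
      by_contra hle
      push Not at hle
      nlinarith [norm_nonneg (lincomb A q x)]
    nlinarith
  linarith

end Clifford

/-- The orthogonal projection onto the tangent space of `unitSet A` at `x`. -/
noncomputable def unitSetProj (A : ι → E →ₗ[ℝ] E) (x : E) : E →ₗ[ℝ] E :=
  (1 / 2 : ℝ) • (LinearMap.id + lincomb A (quadCoeff A x)) + ∑ α, outer (A α x) (A α x)
    - (2 : ℝ) • outer x x

theorem unitSetProj_apply (A : ι → E →ₗ[ℝ] E) (x v : E) :
    unitSetProj A x v = (1 / 2 : ℝ) • (v + lincomb A (quadCoeff A x) v)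
      + ∑ α, inner ℝ (A α x) v • A α x - (2 : ℝ) • inner ℝ x v • x := by
  simp [unitSetProj, LinearMap.sum_apply]

/-- The derivative of `unitSetProj A`. -/
noncomputable def unitSetDProj (A : ι → E →ₗ[ℝ] E) (x : E) : E →ₗ[ℝ] E →ₗ[ℝ] E :=
  LinearMap.mk₂ ℝ
    (fun v w => ∑ α, inner ℝ (A α x) v • A α w
      + ∑ α, (inner ℝ (A α x) w • A α v + inner ℝ (A α v) w • A α x)
      - (2 : ℝ) • (inner ℝ x w • v + inner ℝ v w • x))
    (fun v v' w => by
      simp only [map_add, inner_add_left, inner_add_right, add_smul, smul_add,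
        Finset.sum_add_distrib]; abel)
    (fun c v w => by
      simp only [map_smul, inner_smul_left, inner_smul_right, RCLike.conj_to_real, mul_smul,
        smul_comm _ c, ← smul_add, ← Finset.smul_sum, ← smul_sub])
    (fun v w w' => by
      simp only [map_add, inner_add_right, add_smul, smul_add, Finset.sum_add_distrib]; abel)
    (fun c v w => by
      simp only [map_smul, inner_smul_right, mul_smul, smul_comm _ c, ← smul_add,
        ← Finset.smul_sum, ← smul_sub])

theorem unitSetDProj_apply (A : ι → E →ₗ[ℝ] E) (x v w : E) :
    unitSetDProj A x v w = ∑ α, inner ℝ (A α x) v • A α w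
      + ∑ α, (inner ℝ (A α x) w • A α v + inner ℝ (A α v) w • A α x)
      - (2 : ℝ) • (inner ℝ x w • v + inner ℝ v w • x) := rfl

variable [DecidableEq ι]

theorem unitSetProj_isSymmetric (hA : CliffordFamily A) (x : E) :
    (unitSetProj A x).IsSymmetric := by
  intro v w
  simp only [unitSetProj_apply, inner_sub_left, inner_sub_right, inner_add_left, inner_add_right,
    sum_inner, inner_sum, inner_smul_left, inner_smul_right, RCLike.conj_to_real,
    hA.lincomb_isSymmetric _ v w, real_inner_comm v]
  simp only [mul_comm]

theorem sum_inner_map_smul (hA : CliffordFamily A) {x : E} (hx : x ∈ unitSet A) (v : E) :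
    ∑ α, inner ℝ (A α x) v * quadCoeff A x α = inner ℝ x v := by
  conv_rhs => rw [← lincomb_quadCoeff hA hx, lincomb_apply, sum_inner]
  simp only [inner_smul_left, RCLike.conj_to_real, mul_comm]

theorem inner_unitSetProj (hA : CliffordFamily A) {x : E} (hx : x ∈ unitSet A) (v : E) :
    inner ℝ x (unitSetProj A x v) = 0 := by
  have h1 : inner ℝ x (lincomb A (quadCoeff A x) v) = inner ℝ x v := by
    rw [← hA.lincomb_isSymmetric, lincomb_quadCoeff hA hx]
  simp only [unitSetProj_apply, inner_sub_right, inner_add_right, inner_sum, inner_smul_right, h1,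
    real_inner_self_eq_norm_sq, hx.1, fun α => real_inner_comm (A α x) x]
  have h2 := sum_inner_map_smul hA hx v
  simp only [quadCoeff] at h2
  rw [h2]
  ring

theorem unitSetProj_map (hA : CliffordFamily A) {x : E} (hx : x ∈ unitSet A) (α : ι) :
    unitSetProj A x (A α x) = A α x - quadCoeff A x α • x := by
  rw [unitSetProj_apply, hA.lincomb_map, lincomb_quadCoeff hA hx]
  simp only [hA.inner_map_self_map, hx.1, fun α => real_inner_comm (A α x) x]
  simp only [quadCoeff, one_pow, ite_smul, one_smul, zero_smul, Finset.sum_ite_eq',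
    Finset.mem_univ, if_true]
  module

theorem unitSetProj_self (hA : CliffordFamily A) {x : E} (hx : x ∈ unitSet A) :
    unitSetProj A x x = 0 := by
  have h := inner_unitSetProj hA hx (unitSetProj A x x)
  rw [← unitSetProj_isSymmetric hA x] at h
  exact inner_self_eq_zero.1 h

theorem unitSetProj_lincomb (hA : CliffordFamily A) {x : E} (hx : x ∈ unitSet A) (v : E) :
    unitSetProj A x (lincomb A (quadCoeff A x) v) =
      (1 / 2 : ℝ) • (v + lincomb A (quadCoeff A x) v)
      - ∑ α, inner ℝ (A α x) v • A α x := by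
  have hq : ∑ α, quadCoeff A x α ^ 2 = 1 := hx.2
  have h1 : ∀ α, inner ℝ (A α x) (lincomb A (quadCoeff A x) v) =
      2 * quadCoeff A x α * inner ℝ x v - inner ℝ (A α x) v := by
    intro α
    rw [← hA.lincomb_isSymmetric, hA.lincomb_map, lincomb_quadCoeff hA hx, inner_sub_left,
      inner_smul_left]
    rfl
  have h2 : inner ℝ x (lincomb A (quadCoeff A x) v) = inner ℝ x v := by
    rw [← hA.lincomb_isSymmetric, lincomb_quadCoeff hA hx]
  have h3 : ∑ α, (2 * quadCoeff A x α * inner ℝ x v) • A α x = (2 * inner ℝ x v) • x := by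
    have h4 := lincomb_quadCoeff hA hx
    rw [lincomb_apply] at h4
    have h5 := congrArg ((2 * inner ℝ x v) • ·) h4
    simp only [Finset.smul_sum, smul_smul] at h5
    rw [← h5]
    refine Finset.sum_congr rfl fun α _ => ?_
    congr 1
    ring
  rw [unitSetProj_apply, hA.lincomb_lincomb, hq, one_smul, h2]
  simp only [h1, sub_smul, Finset.sum_sub_distrib, h3]
  module

theorem unitSetProj_proj (hA : CliffordFamily A) {x : E} (hx : x ∈ unitSet A) (v : E) :
    unitSetProj A x (unitSetProj A x v) = unitSetProj A x v := by
  have h3 : ∑ α, inner ℝ (A α x) v • unitSetProj A x (A α x) =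
      ∑ α, inner ℝ (A α x) v • A α x - inner ℝ x v • x := by
    simp only [unitSetProj_map hA hx, smul_sub, Finset.sum_sub_distrib, smul_smul,
      ← Finset.sum_smul, sum_inner_map_smul hA hx]
  conv_lhs => rw [unitSetProj_apply A x v]
  simp only [map_sub, map_add, map_smul, map_sum, unitSetProj_self hA hx, h3,
    unitSetProj_lincomb hA hx]
  rw [unitSetProj_apply A x v]
  module

/-- The right-hand side is the linearization of `‖x‖ = 1` and `∑ ⟨A_α x, x⟩ A_α x = x`, hence the
form in which velocities of curves are tested. -/
theorem unitSetProj_eq_self_iff (hA : CliffordFamily A) {x : E} (hx : x ∈ unitSet A) (v : E) :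
    unitSetProj A x v = v ↔ inner ℝ x v = 0 ∧
      lincomb A (quadCoeff A x) v + (2 : ℝ) • ∑ α, inner ℝ (A α x) v • A α x = v := by
  constructor
  · intro h
    have h0 : inner ℝ x v = 0 := by rw [← h, inner_unitSetProj hA hx]
    refine ⟨h0, ?_⟩
    rw [unitSetProj_apply, h0, zero_smul, smul_zero, sub_zero] at h
    have h1 := congrArg (fun y => (2 : ℝ) • y - v) h
    simp only [smul_add, smul_smul] at h1
    have h2 : (2 : ℝ) • v - v = v := by module
    rw [h2] at h1
    conv_rhs => rw [← h1]
    module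
  · rintro ⟨h1, h2⟩
    rw [unitSetProj_apply, h1]
    conv_rhs => rw [show v = (1 / 2 : ℝ) • v + (1 / 2 : ℝ) • v by module]
    nth_rewrite 5 [← h2]
    module

section Minimal

variable [FiniteDimensional ℝ E]

theorem trace_unitSetProj (hA : CliffordFamily A) (htr : ∀ α, LinearMap.trace ℝ E (A α) = 0)
    {l : ℕ} (hl : Module.finrank ℝ E = 2 * l) {x : E} (hx : x ∈ unitSet A) :
    LinearMap.trace ℝ E (unitSetProj A x) = (l : ℝ) + Fintype.card ι - 2 := by
  simp only [unitSetProj, lincomb, map_sub, map_add, map_smul, map_sum, LinearMap.trace_id,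
    trace_outer, htr, hA.inner_map_map, real_inner_self_eq_norm_sq, hx.1, hl]
  push_cast
  simp only [one_pow, mul_zero, Finset.sum_const_zero, smul_eq_mul, Finset.sum_const,
    Finset.card_univ, nsmul_eq_mul]
  ring

theorem finrank_range_unitSetProj (hA : CliffordFamily A)
    (htr : ∀ α, LinearMap.trace ℝ E (A α) = 0) {l : ℕ} (hl : Module.finrank ℝ E = 2 * l) {d : ℕ}
    (hd : d + 2 = l + Fintype.card ι) {x : E} (hx : x ∈ unitSet A) :
    Module.finrank ℝ (LinearMap.range (unitSetProj A x)) = d := by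
  refine finrank_range_of_trace_eq (unitSetProj_proj hA hx) ?_
  rw [trace_unitSetProj hA htr hl hx]
  have : (d : ℝ) + 2 = l + Fintype.card ι := by exact_mod_cast hd
  linarith

/-- With `n` the cardinality of `ι`, the three parts of the projection contribute `l q_α`, `(2 - n)
q_α` and `-2 q_α`; in the middle one, `β = α` counts `+1` and every other `β` counts `-1`. -/
theorem trace_mul_unitSetProj (hA : CliffordFamily A) (htr : ∀ α, LinearMap.trace ℝ E (A α) = 0)
    {l : ℕ} (hl : Module.finrank ℝ E = 2 * l) (x : E) (α : ι) :
    LinearMap.trace ℝ E (A α * unitSetProj A x) =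
      ((l : ℝ) - Fintype.card ι) * quadCoeff A x α := by
  have hout : ∀ a b, A α * outer a b = outer a (A α b) := by
    intro a b; ext v; simp
  have h1 : ∑ β, (if α = β then (1 : ℝ) else -1) * quadCoeff A x α =
      (2 - Fintype.card ι) * quadCoeff A x α := by
    have : ∀ β, (if α = β then (1 : ℝ) else -1) = (if α = β then 2 else 0) - 1 := by
      intro β; split_ifs <;> norm_num
    rw [← Finset.sum_mul]
    simp only [this, Finset.sum_sub_distrib, Finset.sum_ite_eq, Finset.mem_univ, if_true,
      Finset.sum_const, Finset.card_univ, nsmul_eq_mul, mul_one]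
  simp only [unitSetProj, lincomb, mul_sub, mul_add, Finset.mul_sum, mul_smul_comm, map_sub,
    map_add, map_smul, map_sum, hout, trace_outer, hA.inner_map_conj, hA.trace_mul]
  rw [show A α * LinearMap.id = A α from mul_one _, htr, real_inner_comm (A α x) x]
  change _ + ∑ β, (if α = β then (1 : ℝ) else -1) * quadCoeff A x α - (2 : ℝ) • quadCoeff A x α = _
  rw [h1, hl]
  push_cast
  simp only [smul_eq_mul, mul_ite, mul_zero, Finset.sum_ite_eq, Finset.mem_univ, if_true]
  ring

theorem unitSet_minimalTangentData (hA : CliffordFamily A)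
    (htr : ∀ α, LinearMap.trace ℝ E (A α) = 0) {l : ℕ} (hl : Module.finrank ℝ E = 2 * l) {d : ℕ}
    (hd : d + 2 = l + Fintype.card ι) :
    MinimalTangentData (unitSet A) d (unitSetProj A) (unitSetDProj A) where
  symm x _ := unitSetProj_isSymmetric hA x
  finrank_range x hx := finrank_range_unitSetProj hA htr hl hd hx
  tangent c v hc hv := by
    rw [unitSetProj_eq_self_iff hA hc.self_of_nhds]
    refine ⟨inner_eq_zero_of_eventually_norm_eq_one (hc.mono fun t ht => ht.1) hv, ?_⟩
    have h1 := HasDerivAt.fun_sum (u := Finset.univ) fun α _ =>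
      (hasDerivAt_inner_map_self (hA.symm α) hv).smul (hv.linearMap_apply (A α))
    have h2 : (fun t => ∑ α, inner ℝ (A α (c t)) (c t) • A α (c t)) =ᶠ[𝓝 0] c := by
      filter_upwards [hc] with t ht
      have := lincomb_quadCoeff hA ht
      rwa [lincomb_apply] at this
    have h3 := (h1.congr_of_eventuallyEq h2.symm).unique hv
    rw [lincomb_apply, Finset.smul_sum, ← Finset.sum_add_distrib]
    simp only [smul_smul]
    exact h3
  hasDerivAt y w y' w' hy hw := by
    have hq : HasDerivAt (fun t => lincomb A (quadCoeff A (y t)) (w t))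
        (∑ α, (quadCoeff A (y 0) α • A α w' + (2 * inner ℝ (A α (y 0)) y') • A α (w 0))) 0 := by
      simp only [lincomb_apply]
      exact HasDerivAt.fun_sum (u := Finset.univ) fun α _ =>
        (hasDerivAt_inner_map_self (hA.symm α) hy).smul (hw.linearMap_apply (A α))
    have h1 := (((hw.add hq).const_smul (1 / 2 : ℝ)).add
      (HasDerivAt.fun_sum (u := Finset.univ) fun α _ =>
        ((hy.linearMap_apply (A α)).inner ℝ hw).smul (hy.linearMap_apply (A α)))).sub
      (((hy.inner ℝ hw).smul hy).const_smul (2 : ℝ))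
    simp only [unitSetProj_apply]
    refine h1.congr_deriv ?_
    simp only [unitSetDProj_apply, lincomb_apply, add_smul, Finset.sum_add_distrib, mul_smul,
      ← Finset.smul_sum]
    module
  minimal x hx κ _ b := by
    have hsum : ∑ α, quadCoeff A x α • A α x = x := by
      have := lincomb_quadCoeff hA hx
      rwa [lincomb_apply] at this
    have h1 : ∑ k, inner ℝ x (b k) • unitSetProj A x (b k) = 0 := by
      rw [sum_inner_smul_map, unitSetProj_self hA hx]
    have h2 : ∑ k, inner ℝ (unitSetProj A x (b k)) (b k) = (l : ℝ) + Fintype.card ι - 2 := by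
      rw [sum_inner_map_self, trace_unitSetProj hA htr hl hx]
    have h3 : ∀ α, A α (unitSetProj A x (A α x)) = x - quadCoeff A x α • A α x := by
      intro α
      rw [unitSetProj_map hA hx, map_sub, map_smul, hA.apply_apply]
    have h4 : ∀ α, ∑ k, inner ℝ (A α x) (b k) • A α (unitSetProj A x (b k)) =
        x - quadCoeff A x α • A α x := by
      intro α
      rw [← h3]
      exact sum_inner_smul_map b (A α * unitSetProj A x) (A α x)
    have h5 : ∀ α, ∑ k, inner ℝ (A α x) (unitSetProj A x (b k)) • A α (b k) =
        x - quadCoeff A x α • A α x := by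
      intro α
      rw [← h3]
      simp only [← unitSetProj_isSymmetric hA x (A α x)]
      exact sum_inner_smul_map b (A α) (unitSetProj A x (A α x))
    have h6 : ∀ α, ∑ k, inner ℝ (A α (unitSetProj A x (b k))) (b k) =
        ((l : ℝ) - Fintype.card ι) * quadCoeff A x α := by
      intro α
      rw [← trace_mul_unitSetProj hA htr hl]
      exact sum_inner_map_self b (A α * unitSetProj A x)
    have h7 : ∑ α, (x - quadCoeff A x α • A α x) = (Fintype.card ι : ℝ) • x - x := by
      rw [Finset.sum_sub_distrib, hsum, Finset.sum_const, Finset.card_univ, Nat.cast_smul_eq_nsmul]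
    have hd' : (d : ℝ) = l + Fintype.card ι - 2 := by
      have : (d : ℝ) + 2 = l + Fintype.card ι := by exact_mod_cast hd
      linarith
    simp only [unitSetDProj_apply, Finset.sum_sub_distrib, Finset.sum_add_distrib,
      ← Finset.smul_sum, h1, ← Finset.sum_smul, h2]
    rw [Finset.sum_comm (f := fun k α => inner ℝ (A α x) (unitSetProj A x (b k)) • A α (b k)),
      Finset.sum_comm (f := fun k α => inner ℝ (A α x) (b k) • A α (unitSetProj A x (b k))),
      Finset.sum_comm (f := fun k α => inner ℝ (A α (unitSetProj A x (b k))) (b k) • A α x)]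
    -- With `n` the cardinality of `ι`, the coefficient of `x` is `2 (n - 1) + (l - n) - 2 (l + n -
    -- 2) = -(l + n - 2) = -d`.
    simp only [← Finset.sum_smul, h4, h5, h6, h7]
    simp only [mul_smul, ← Finset.smul_sum, hsum, hd']
    module

end Minimal

end UnitSet

/-! ### Unit sets are submanifolds, by a smooth retraction. -/

section UnitSetRetraction

variable {E : Type*} [NormedAddCommGroup E] [InnerProductSpace ℝ E]
  {ι : Type*} [Fintype ι]

/-- The sum `∑_α ⟨A_α x, x⟩²`. -/
noncomputable def quadSum (A : ι → E →ₗ[ℝ] E) (x : E) : ℝ := ∑ α, inner ℝ (A α x) x ^ 2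

/-- Up to a positive factor, the projection of `z` onto the `1`-eigenspace of the unit Clifford
operator `∑_α ⟨A_α z, z⟩ A_α / √(∑_α ⟨A_α z, z⟩²)`. -/
noncomputable def eigenpart (A : ι → E →ₗ[ℝ] E) (z : E) : E :=
  √(quadSum A z) • z + lincomb A (quadCoeff A z) z

/-- The retraction onto `unitSet A`. -/
noncomputable def unitSetRetract (A : ι → E →ₗ[ℝ] E) (z : E) : E :=
  (√(inner ℝ (eigenpart A z) (eigenpart A z)))⁻¹ • eigenpart A z

/-- The domain of the retraction onto `unitSet A`. -/
def unitSetNhd (A : ι → E →ₗ[ℝ] E) : Set E := {z | quadSum A z ≠ 0 ∧ eigenpart A z ≠ 0}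

section Smooth

variable [FiniteDimensional ℝ E]

theorem contDiff_map (T : E →ₗ[ℝ] E) : ContDiff ℝ ∞ fun z => T z :=
  (LinearMap.toContinuousLinearMap T).contDiff

theorem contDiff_quadSum (A : ι → E →ₗ[ℝ] E) : ContDiff ℝ ∞ (quadSum A) :=
  ContDiff.sum fun α _ => ((contDiff_map (A α)).inner ℝ contDiff_id).pow 2

theorem contDiff_lincomb_quadCoeff (A : ι → E →ₗ[ℝ] E) :
    ContDiff ℝ ∞ fun z => lincomb A (quadCoeff A z) z := by
  simp only [lincomb_apply]
  exact ContDiff.sum fun α _ => ((contDiff_map (A α)).inner ℝ contDiff_id).smul (contDiff_map (A α))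

theorem isOpen_unitSetNhd (A : ι → E →ₗ[ℝ] E) : IsOpen (unitSetNhd A) := by
  have h1 : Continuous (quadSum A) := (contDiff_quadSum A).continuous
  have h2 : Continuous (eigenpart A) :=
    (h1.sqrt.smul continuous_id).add (contDiff_lincomb_quadCoeff A).continuous
  exact (isOpen_ne_fun h1 continuous_const).inter (isOpen_ne_fun h2 continuous_const)

theorem contDiffOn_unitSetRetract (A : ι → E →ₗ[ℝ] E) :
    ContDiffOn ℝ ∞ (unitSetRetract A) (unitSetNhd A) := by
  rintro z ⟨hz1, hz2⟩
  refine ContDiffAt.contDiffWithinAt ?_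
  have h1 : ContDiffAt ℝ ∞ (eigenpart A) z :=
    (((contDiff_quadSum A).contDiffAt.sqrt hz1).smul contDiffAt_id).add
      (contDiff_lincomb_quadCoeff A).contDiffAt
  have h2 : inner ℝ (eigenpart A z) (eigenpart A z) ≠ 0 := inner_self_ne_zero.2 hz2
  refine (((h1.inner ℝ h1).sqrt h2).inv ?_).smul h1
  exact (Real.sqrt_pos.2 (lt_of_le_of_ne real_inner_self_nonneg h2.symm)).ne'

end Smooth

variable {A : ι → E →ₗ[ℝ] E} [DecidableEq ι]

theorem eigenpart_of_mem (hA : CliffordFamily A) {x : E} (hx : x ∈ unitSet A) :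
    eigenpart A x = (2 : ℝ) • x := by
  rw [eigenpart, lincomb_quadCoeff hA hx, show quadSum A x = 1 from hx.2, Real.sqrt_one, one_smul,
    two_smul]

theorem sqrt_inner_eigenpart_of_mem (hA : CliffordFamily A) {x : E} (hx : x ∈ unitSet A) :
    √(inner ℝ (eigenpart A x) (eigenpart A x)) = 2 := by
  rw [eigenpart_of_mem hA hx, real_inner_self_eq_norm_sq, Real.sqrt_sq (norm_nonneg _), norm_smul,
    hx.1]
  norm_num

theorem unitSetRetract_of_mem (hA : CliffordFamily A) {x : E} (hx : x ∈ unitSet A) :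
    unitSetRetract A x = x := by
  rw [unitSetRetract, sqrt_inner_eigenpart_of_mem hA hx, eigenpart_of_mem hA hx, smul_smul]
  norm_num

theorem unitSet_subset_unitSetNhd (hA : CliffordFamily A) : unitSet A ⊆ unitSetNhd A := by
  intro x hx
  refine ⟨by rw [show quadSum A x = 1 from hx.2]; norm_num, ?_⟩
  rw [eigenpart_of_mem hA hx]
  have : x ≠ 0 := by
    rintro rfl
    simpa using hx.1
  exact smul_ne_zero two_ne_zero this

/-- The normalized coefficients `c = q / |q|` define an involution that fixes `eigenpart A z`, so
`mem_unitSet_of_lincomb` applies. -/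
theorem mapsTo_unitSetRetract (hA : CliffordFamily A) :
    Set.MapsTo (unitSetRetract A) (unitSetNhd A) (unitSet A) := by
  rintro z ⟨hz1, hz2⟩
  have h0 : 0 ≤ quadSum A z := Finset.sum_nonneg fun α _ => sq_nonneg _
  have hs : √(quadSum A z) ≠ 0 := (Real.sqrt_pos.2 (lt_of_le_of_ne h0 hz1.symm)).ne'
  have hss : √(quadSum A z) * √(quadSum A z) = quadSum A z := Real.mul_self_sqrt h0
  have hsum : ∑ α, quadCoeff A z α ^ 2 = quadSum A z := rfl
  have hc : lincomb A (fun α => (√(quadSum A z))⁻¹ * quadCoeff A z α) =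
      (√(quadSum A z))⁻¹ • lincomb A (quadCoeff A z) := by
    simp only [lincomb, Finset.smul_sum, smul_smul]
  refine mem_unitSet_of_lincomb hA (c := fun α => (√(quadSum A z))⁻¹ * quadCoeff A z α) ?_ ?_ ?_
  · rw [unitSetRetract, real_inner_self_eq_norm_sq, Real.sqrt_sq (norm_nonneg _), norm_smul,
      norm_inv, norm_norm, inv_mul_cancel₀ (norm_ne_zero_iff.2 hz2)]
  · simp only [mul_pow, ← Finset.mul_sum, hsum]
    field_simp
    rw [sq, hss]
  · rw [hc, unitSetRetract, LinearMap.smul_apply, map_smul, smul_comm]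
    congr 1
    rw [eigenpart, map_add, map_smul, hA.lincomb_lincomb, hsum, smul_add, smul_smul, smul_smul,
      inv_mul_cancel₀ hs, one_smul, add_comm]
    congr 2
    field_simp
    rw [sq, hss]

variable [FiniteDimensional ℝ E]

/-- No curve in `unitSet A` with velocity `w` is available yet, so the derivative is computed along
the line `x + t w`: to first order `quadSum` is constant, `eigenpart` moves by `2 w`, and its norm
is constant because `w ⊥ x`. -/
theorem fderiv_unitSetRetract_of_tangent (hA : CliffordFamily A) {x : E} (hx : x ∈ unitSet A)
    {w : E} (hw : unitSetProj A x w = w) : fderiv ℝ (unitSetRetract A) x w = w := by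
  obtain ⟨hw0, hw1⟩ := (unitSetProj_eq_self_iff hA hx w).1 hw
  have hline := hasDerivAt_add_smul x w
  have hx0 : x + (0 : ℝ) • w = x := by simp
  have hS : HasDerivAt (fun t : ℝ => quadSum A (x + t • w)) 0 0 := by
    have h := HasDerivAt.fun_sum (u := Finset.univ) fun α _ =>
      (hasDerivAt_inner_map_self (hA.symm α) hline).pow 2
    refine h.congr_deriv ?_
    have h1 := sum_inner_map_smul hA hx w
    rw [hw0] at h1
    simp only [hx0]
    have h2 : ∀ α, ((2 : ℕ) : ℝ) * inner ℝ (A α x) x ^ (2 - 1) * (2 * inner ℝ (A α x) w) =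
        4 * (inner ℝ (A α x) w * quadCoeff A x α) := by
      intro α
      simp only [quadCoeff]
      push_cast
      ring
    simp only [h2, ← Finset.mul_sum, h1, mul_zero]
  have hS1 : quadSum A (x + (0 : ℝ) • w) = 1 := by rw [hx0]; exact hx.2
  have hg : HasDerivAt (fun t : ℝ => eigenpart A (x + t • w)) ((2 : ℝ) • w) 0 := by
    have h1 := (hS.sqrt (by rw [hS1]; norm_num)).smul hline
    have h2 := HasDerivAt.fun_sum (u := Finset.univ) fun α _ =>
      (hasDerivAt_inner_map_self (hA.symm α) hline).smul (hline.linearMap_apply (A α))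
    have h3 := h1.add h2
    refine (h3.congr_deriv ?_).congr_of_eventuallyEq (Eventually.of_forall fun t => ?_)
    · rw [hS1, hx0, Finset.sum_add_distrib, Real.sqrt_one, zero_div, zero_smul, add_zero, one_smul,
        two_smul]
      congr 1
      rw [lincomb_apply, Finset.smul_sum] at hw1
      simp only [smul_smul] at hw1
      exact hw1
    · simp only [eigenpart, lincomb_apply]
      rfl
  have hr : HasDerivAt (fun t : ℝ => unitSetRetract A (x + t • w)) w 0 := by
    have hgx : eigenpart A (x + (0 : ℝ) • w) = (2 : ℝ) • x := by
      rw [hx0, eigenpart_of_mem hA hx]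
    have hsq : √(inner ℝ (eigenpart A (x + (0 : ℝ) • w)) (eigenpart A (x + (0 : ℝ) • w))) = 2 := by
      rw [hx0, sqrt_inner_eigenpart_of_mem hA hx]
    have hne : inner ℝ (eigenpart A (x + (0 : ℝ) • w)) (eigenpart A (x + (0 : ℝ) • w)) ≠ 0 := by
      intro h0
      rw [h0, Real.sqrt_zero] at hsq
      norm_num at hsq
    have h1 := (((hg.inner ℝ hg).sqrt hne).inv (by rw [hsq]; norm_num)).smul hg
    refine h1.congr_deriv ?_
    have h2 : inner ℝ ((2 : ℝ) • x) ((2 : ℝ) • w) + inner ℝ ((2 : ℝ) • w) ((2 : ℝ) • x) = 0 := by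
      simp [inner_smul_left, inner_smul_right, real_inner_comm x w, hw0]
    rw [Pi.inv_apply, hsq, hgx, h2]
    rw [zero_div, neg_zero, zero_div, zero_smul, add_zero, smul_smul]
    norm_num
  exact (hasDerivAt_line (((contDiffOn_unitSetRetract A).contDiffAt ((isOpen_unitSetNhd A).mem_nhds
    (unitSet_subset_unitSetNhd hA hx))).differentiableAt (by simp)) w).unique hr

theorem unitSet_isEmbeddedSubmanifold (hA : CliffordFamily A)
    (htr : ∀ α, LinearMap.trace ℝ E (A α) = 0) {l : ℕ} (hl : Module.finrank ℝ E = 2 * l) {d : ℕ}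
    (hd : d + 2 = l + Fintype.card ι) : IsEmbeddedSubmanifold (unitSet A) d := by
  intro x hx
  have hO := isOpen_unitSetNhd A
  have hxO := unitSet_subset_unitSetNhd hA hx
  have hr := contDiffOn_unitSetRetract A
  have hrM := mapsTo_unitSetRetract hA
  have hx0 : unitSetRetract A x = x := unitSetRetract_of_mem hA hx
  refine exists_isLocalParam_of_retraction hx hO hxO hr hrM
    (fun z hz => unitSetRetract_of_mem hA hz) ?_
  -- The image of a line under the retraction is a curve in `unitSet A`, which gives one inclusion;
  -- the differential fixes tangent vectors, which gives the other.
  suffices h : LinearMap.range (fderiv ℝ (unitSetRetract A) x).toLinearMap =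
      LinearMap.range (unitSetProj A x) by
    rw [h, finrank_range_unitSetProj hA htr hl hd hx]
  refine le_antisymm ?_ ?_
  · rintro _ ⟨v, rfl⟩
    refine ⟨fderiv ℝ (unitSetRetract A) x v, ?_⟩
    have hmem : ∀ᶠ t : ℝ in 𝓝 0, x + t • v ∈ unitSetNhd A :=
      (hasDerivAt_add_smul x v).continuousAt.preimage_mem_nhds (by simpa using hO.mem_nhds hxO)
    have := (unitSet_minimalTangentData hA htr hl hd).tangent _ _
      (hmem.mono fun t ht => hrM ht)
      (hasDerivAt_line ((hr.contDiffAt (hO.mem_nhds hxO)).differentiableAt (by simp)) v)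
    simpa [hx0] using this
  · rintro _ ⟨v, rfl⟩
    exact ⟨unitSetProj A x v,
      fderiv_unitSetRetract_of_tangent hA hx (unitSetProj_proj hA hx v)⟩

end UnitSetRetraction

/-! ### Surjectivity and submersivity of the focal maps. -/

section FocalMapsOfCliffordFamilies

variable {E : Type*} [NormedAddCommGroup E] [InnerProductSpace ℝ E] {B : E →ₗ[ℝ] E} {ε : ℝ}

theorem ne_zero_of_mul_self (hε : ε * ε = 1) : ε ≠ 0 := by
  rintro rfl
  norm_num at hε

theorem inner_eq_zero_of_opposite (hB : B.IsSymmetric) (hε : ε * ε = 1) {y z : E}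
    (hy : B y = ε • y) (hz : B z = -(ε • z)) : inner ℝ y z = 0 := by
  have h := hB y z
  rw [hy, hz, inner_smul_left, inner_neg_right, inner_smul_right, RCLike.conj_to_real] at h
  have h2 : ε * inner ℝ y z = 0 := by linarith
  exact (mul_eq_zero.1 h2).resolve_left (ne_zero_of_mul_self hε)

theorem focalLin_of_eigen (hε : ε * ε = 1) {w : E} (hw : B w = ε • w) :
    focalLin B ε w = √2 • w := by
  rw [focalLin_apply, hw, smul_smul, hε, one_smul, ← two_smul ℝ w, smul_smul]
  congr 1
  have h2 : √2 * √2 = 2 := Real.mul_self_sqrt (by norm_num)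
  have h0 : √2 ≠ 0 := by positivity
  field_simp
  linarith

theorem focalLin_of_opposite (hε : ε * ε = 1) {w : E} (hw : B w = -(ε • w)) :
    focalLin B ε w = 0 := by
  rw [focalLin_apply, hw, smul_neg, smul_smul, hε, one_smul, add_neg_cancel, smul_zero]

theorem focalLin_half_add (hε : ε * ε = 1) {w z : E} (hw : B w = ε • w) (hz : B z = -(ε • z)) :
    focalLin B ε ((1 / √2 : ℝ) • (w + z)) = w := by
  have h0 : √2 ≠ 0 := by positivity
  rw [map_smul, map_add, focalLin_of_eigen hε hw, focalLin_of_opposite hε hz, add_zero, smul_smul,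
    one_div_mul_cancel h0, one_smul]

theorem norm_half_add {y z : E} (hy : ‖y‖ = 1) (hz : ‖z‖ = 1) (hyz : inner ℝ y z = 0) :
    ‖(1 / √2 : ℝ) • (y + z)‖ = 1 := by
  have h : ‖(1 / √2 : ℝ) • (y + z)‖ ^ 2 = 1 := by
    rw [← real_inner_self_eq_norm_sq, inner_smul_left, inner_smul_right, inner_add_left,
      inner_add_right, inner_add_right, real_inner_self_eq_norm_sq, real_inner_self_eq_norm_sq,
      real_inner_comm y z, hyz, hy, hz, RCLike.conj_to_real]
    linear_combination 2 * one_div_sqrt_two_mul_self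
  nlinarith [norm_nonneg ((1 / √2 : ℝ) • (y + z))]

theorem inner_eq_zero_of_inner_focalLin (hB : B.IsSymmetric) (hε : ε * ε = 1) {x w : E}
    (hw : B w = ε • w) (h : inner ℝ (focalLin B ε x) w = 0) :
    inner ℝ x w = 0 ∧ inner ℝ (B x) w = 0 := by
  have h1 : inner ℝ (B x) w = ε * inner ℝ x w := by rw [hB, hw, inner_smul_right]
  rw [focalLin_apply, inner_smul_left, inner_add_left, inner_smul_left, h1, RCLike.conj_to_real,
    RCLike.conj_to_real, ← mul_assoc ε, hε] at h
  have h0 : (1 / √2 : ℝ) ≠ 0 := by positivity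
  have h2 : inner ℝ x w = 0 := by
    have := (mul_eq_zero.1 h).resolve_left h0
    linarith
  exact ⟨h2, by rw [h1, h2, mul_zero]⟩

variable {ι : Type*} [DecidableEq ι] {A : ι → E →ₗ[ℝ] E}

/-- For distinct `α`, `β`, `t` the product `A β * A α * A t` is skew-symmetric, since reversing
three anticommuting factors changes the sign. -/
theorem CliffordFamily.inner_map_map_map (hA : CliffordFamily A) {α β t : ι} (hα : α ≠ t)
    (hβ : β ≠ t) (x : E) (hx : inner ℝ (A t x) x = 0) :
    inner ℝ (A β x) (A α (A t x)) = 0 := by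
  by_cases hαβ : α = β
  · rw [hαβ, hA.inner_map_map, real_inner_comm, hx]
  · have h1 : inner ℝ (A β x) (A α (A t x)) = inner ℝ (A β (A t x)) (A α x) := by
      rw [hA.apply_apply_of_ne hα, inner_neg_right, ← hA.symm t, hA.apply_apply_of_ne hβ.symm,
        inner_neg_left, neg_neg]
    have h2 : inner ℝ (A β x) (A α (A t x)) = -inner ℝ (A β (A t x)) (A α x) := by
      rw [← hA.symm α, hA.apply_apply_of_ne hαβ, inner_neg_left, hA.symm β, real_inner_comm]
    linarith

variable [Fintype ι]

theorem zeroSet_submersive (hA : CliffordFamily A) (t : ι) (hε : ε * ε = 1) {x : E}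
    (hx : x ∈ zeroSet A) {w : E} (hw : A t w = ε • w)
    (hxw : inner ℝ (focalLin (A t) ε x) w = 0) :
    ∃ v, zeroSetProj A x v = v ∧ focalLin (A t) ε v = w := by
  obtain ⟨hxw0, hxw1⟩ := inner_eq_zero_of_inner_focalLin (hA.symm t) hε hw hxw
  set y := focalLin (A t) ε x with hy
  have hty : A t y = ε • y := map_focalLin (hA.apply_apply t) hε x
  have hAy : ∀ α, A α y = (1 / √2 : ℝ) • (A α x + ε • A α (A t x)) := by
    intro α
    rw [hy, focalLin_apply, map_smul, map_add, map_smul]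
  have h1 : ∀ α, α ≠ t → inner ℝ x (A α y) = 0 := by
    intro α hα
    rw [hAy, inner_smul_right, inner_add_right, inner_smul_right, inner_map_of_mem_zeroSet hx,
      ← hA.symm α, hA.inner_map_map_eq_zero hα]
    simp
  have h2 : ∀ α, α ≠ t → inner ℝ (A t x) (A α y) = 0 := by
    intro α hα
    rw [hAy, inner_smul_right, inner_add_right, inner_smul_right,
      hA.inner_map_map_eq_zero hα.symm, hA.inner_map_conj, hx.2]
    simp
  have h3 : ∀ α β, α ≠ t → β ≠ t →
      inner ℝ (A β x) (A α y) = if β = α then (1 / √2 : ℝ) else 0 := by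
    intro α β hα hβ
    rw [hAy, inner_smul_right, inner_add_right, inner_smul_right,
      hA.inner_map_map_map hα hβ x (hx.2 t), hA.inner_map_self_map, hx.1]
    split_ifs <;> simp
  set s := Finset.univ.filter fun α => α ≠ t with hs
  have hst : ∀ α ∈ s, α ≠ t := fun α hα => (Finset.mem_filter.1 hα).2
  -- The first term maps to `w`. The `A α y` with `α ≠ t` lie in the opposite eigenspace, hence are
  -- killed, and by `h3` these coefficients make the vector orthogonal to every `A β x`.
  refine ⟨(1 / √2 : ℝ) • w - ∑ α ∈ s, inner ℝ (A α x) w • A α y, ?_, ?_⟩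
  · rw [zeroSetProj_eq_self_iff hA hx]
    constructor
    · rw [inner_sub_right, inner_smul_right, hxw0, inner_sum, Finset.sum_eq_zero]
      · simp
      · intro α hα
        rw [inner_smul_right, h1 α (hst α hα), mul_zero]
    · intro β
      by_cases hβ : β = t
      · rw [hβ, inner_sub_right, inner_smul_right, hxw1, inner_sum, Finset.sum_eq_zero]
        · simp
        · intro α hα
          rw [inner_smul_right, h2 α (hst α hα), mul_zero]
      · have h4 : ∑ α ∈ s, inner ℝ (A β x) (inner ℝ (A α x) w • A α y) =
            ∑ α ∈ s, if β = α then (1 / √2 : ℝ) * inner ℝ (A β x) w else 0 := by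
          refine Finset.sum_congr rfl fun α hα => ?_
          rw [inner_smul_right, h3 α β (hst α hα) hβ]
          split_ifs with h5
          · rw [h5, mul_comm]
          · rw [mul_zero]
        rw [inner_sub_right, inner_smul_right, inner_sum, h4, Finset.sum_ite_eq, if_pos, sub_self]
        simp [hs, hβ]
  · have h0 : √2 ≠ 0 := by positivity
    rw [map_sub, map_smul, focalLin_of_eigen hε hw, smul_smul, one_div_mul_cancel h0, one_smul,
      map_sum, Finset.sum_eq_zero, sub_zero]
    intro α hα
    rw [map_smul, focalLin_of_opposite hε, smul_zero]
    rw [hA.apply_apply_of_ne (hst α hα).symm, hty, map_smul]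

variable [FiniteDimensional ℝ E]

/-- A unit `z` in the `l`-dimensional opposite eigenspace has to satisfy `⟨A α y, z⟩ = 0` for `α ≠
t`. These are fewer than `l` linear equations, and `(y + z) / √2` is then a preimage. -/
theorem zeroSet_exists_focalLin_eq (hA : CliffordFamily A) (t : ι) (hε : ε * ε = 1) {l : ℕ}
    (hl : ∀ δ : ℝ, δ * δ = 1 → Module.finrank ℝ (Module.End.eigenspace (A t) δ) = l)
    (hcard : Fintype.card ι ≤ l) {y : E} (hy : ‖y‖ = 1) (hty : A t y = ε • y) :
    ∃ x ∈ zeroSet A, focalLin (A t) ε x = y := by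
  let F : Module.End.eigenspace (A t) (-ε) →ₗ[ℝ] ({α // α ≠ t} → ℝ) :=
    LinearMap.pi fun α => (innerₛₗ ℝ (A α y)) ∘ₗ (Module.End.eigenspace (A t) (-ε)).subtype
  have hF : Module.finrank ℝ ({α // α ≠ t} → ℝ) <
      Module.finrank ℝ (Module.End.eigenspace (A t) (-ε)) := by
    rw [hl (-ε) (by rw [neg_mul_neg, hε]), Module.finrank_fintype_fun_eq_card]
    have : Fintype.card {α // α ≠ t} < Fintype.card ι :=
      Fintype.card_subtype_lt (x := t) (by simp)
    omega
  obtain ⟨z₀, hz₀, hz₀0⟩ := Submodule.exists_mem_ne_zero_of_ne_bot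
    (LinearMap.ker_ne_bot_of_finrank_lt (f := F) hF)
  have hFz : F z₀ = 0 := LinearMap.mem_ker.1 hz₀
  have hn : ‖(z₀ : E)‖ ≠ 0 := by simpa using hz₀0
  set z : E := ‖(z₀ : E)‖⁻¹ • (z₀ : E) with hz
  have hz1 : ‖z‖ = 1 := by rw [hz, norm_smul, norm_inv, norm_norm, inv_mul_cancel₀ hn]
  have htz : A t z = -(ε • z) := by
    rw [hz, map_smul, Module.End.mem_eigenspace_iff.1 z₀.2, neg_smul, smul_neg, smul_comm]
  have hyz' : ∀ α, α ≠ t → inner ℝ (A α y) z = 0 := by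
    intro α hα
    have h1 : inner ℝ (A α y) (z₀ : E) = 0 := congrFun hFz ⟨α, hα⟩
    rw [hz, inner_smul_right, h1, mul_zero]
  have hyz : inner ℝ y z = 0 := inner_eq_zero_of_opposite (hA.symm t) hε hty htz
  refine ⟨(1 / √2 : ℝ) • (y + z), ⟨norm_half_add hy hz1 hyz, fun α => ?_⟩,
    focalLin_half_add hε hty htz⟩
  rw [map_smul, inner_smul_left, inner_smul_right, map_add, inner_add_left, inner_add_right,
    inner_add_right]
  suffices h : inner ℝ (A α y) y + inner ℝ (A α y) z +
      (inner ℝ (A α z) y + inner ℝ (A α z) z) = 0 by rw [h]; simp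
  by_cases hα : α = t
  · rw [hα, hty, htz]
    simp only [inner_neg_left, inner_smul_left, real_inner_self_eq_norm_sq, hy, hz1,
      real_inner_comm y z, hyz]
    simp
  · have h1 : inner ℝ (A α y) y = 0 := by
      rw [real_inner_comm]
      refine inner_eq_zero_of_opposite (hA.symm t) hε hty ?_
      rw [hA.apply_apply_of_ne (Ne.symm hα), hty, map_smul]
    have h2 : inner ℝ (A α z) z = 0 := by
      refine inner_eq_zero_of_opposite (hA.symm t) hε ?_ htz
      rw [hA.apply_apply_of_ne (Ne.symm hα), htz, map_neg, neg_neg, map_smul]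
    have h3 : inner ℝ (A α z) y = 0 := by rw [hA.symm, real_inner_comm, hyz' α hα]
    rw [h1, h2, h3, hyz' α hα]
    norm_num

/-- The focal maps of the zero set of a Clifford family are submersive eigenmaps. -/
theorem zeroSet_isSubmersiveEigenmapOnto (hA : CliffordFamily A) (t : ι) (hε : ε * ε = 1)
    {l d : ℕ} (hE : Module.finrank ℝ E = 2 * l) (hd : 2 * l = d + 1 + Fintype.card ι)
    (hcard : 2 ≤ Fintype.card ι) (hcard' : Fintype.card ι ≤ l) :
    IsSubmersiveEigenmapOnto (zeroSet A) d l (focalLin (A t) ε)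
      {y | ‖y‖ = 1 ∧ A t y = ε • y} d := by
  have : Nontrivial ι := Fintype.one_lt_card_iff_nontrivial.1 hcard
  have htr : ∀ α, LinearMap.trace ℝ E (A α) = 0 := fun α => by
    obtain ⟨β, hβ⟩ := exists_ne α
    exact hA.trace_eq_zero hβ.symm
  have hl : ∀ δ : ℝ, δ * δ = 1 → Module.finrank ℝ (Module.End.eigenspace (A t) δ) = l :=
    fun δ hδ => finrank_eigenspace_of_involution (hA.apply_apply t) (htr t) hδ hE
  refine (zeroSet_minimalTangentData hA htr (hE.trans hd)).isSubmersiveEigenmapOnto (hA.symm t)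
    (hA.apply_apply t) hε (hl ε hε) (fun x hx => hx.1) (fun x hx => hx.2 t) ?_ ?_ ?_
  · intro x hx v hv
    rw [zeroSetProj_eq_self_iff hA hx] at hv
    exact ⟨hv.1, hv.2 t⟩
  · exact fun y hy hty => zeroSet_exists_focalLin_eq hA t hε hl hcard' hy hty
  · exact fun x hx w hw hxw => zeroSet_submersive hA t hε hx hw hxw

/-- The focal maps of the unit set of a Clifford family, with respect to a further operator `B`
extending the family, are submersive eigenmaps. -/
theorem unitSet_isSubmersiveEigenmapOnto [Nonempty ι] (hA : CliffordFamily A)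
    (hB : B.IsSymmetric) (hBB : ∀ x, B (B x) = x) (hBA : ∀ α x, B (A α x) = -A α (B x))
    (htr : ∀ α, LinearMap.trace ℝ E (A α) = 0) (htrB : LinearMap.trace ℝ E B = 0)
    (hε : ε * ε = 1) {l d : ℕ} (hE : Module.finrank ℝ E = 2 * l)
    (hd : d + 2 = l + Fintype.card ι) :
    IsSubmersiveEigenmapOnto (unitSet A) d l (focalLin B ε) {y | ‖y‖ = 1 ∧ B y = ε • y} d := by
  have hBP : ∀ c x, B (lincomb A c x) = -lincomb A c (B x) := by
    intro c x
    simp only [lincomb_apply, map_sum, map_smul, hBA, smul_neg, Finset.sum_neg_distrib]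
  have hBP' : ∀ {x v : E}, x ∈ unitSet A →
      inner ℝ (B x) (lincomb A (quadCoeff A x) v) = -inner ℝ (B x) v := by
    intro x v hx
    have h1 : lincomb A (quadCoeff A x) (B x) = -B x := by
      rw [eq_neg_iff_add_eq_zero, ← neg_eq_iff_add_eq_zero, ← hBP, lincomb_quadCoeff hA hx]
    rw [← hA.lincomb_isSymmetric, h1, inner_neg_left]
  have hBAx : ∀ α x, inner ℝ (B x) (A α x) = 0 := by
    intro α x
    have h1 : inner ℝ (B x) (A α x) = -inner ℝ (A α x) (B x) := by
      rw [hB, hBA, inner_neg_right, hA.symm]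
    rw [real_inner_comm (B x)] at h1
    linarith
  refine (unitSet_minimalTangentData hA htr hE hd).isSubmersiveEigenmapOnto hB hBB hε
    (finrank_eigenspace_of_involution hBB htrB hε hE) (fun x hx => hx.1) ?_ ?_ ?_ ?_
  · intro x hx
    have h1 := hBP' (v := x) hx
    rw [lincomb_quadCoeff hA hx] at h1
    linarith
  · intro x hx v hv
    obtain ⟨h1, h2⟩ := (unitSetProj_eq_self_iff hA hx v).1 hv
    refine ⟨h1, ?_⟩
    have h3 := congrArg (inner ℝ (B x)) h2
    rw [inner_add_right, inner_smul_right, inner_sum, hBP' hx] at h3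
    simp only [inner_smul_right, hBAx, mul_zero, Finset.sum_const_zero] at h3
    linarith
  · intro y hy hBy
    let α : ι := Classical.arbitrary ι
    have hz : B (A α y) = -(ε • A α y) := by rw [hBA, hBy, map_smul]
    have hyz : inner ℝ y (A α y) = 0 := inner_eq_zero_of_opposite hB hε hBy hz
    have hz1 : ‖A α y‖ = 1 := by
      have h1 := hA.inner_map_map α y y
      rw [real_inner_self_eq_norm_sq, real_inner_self_eq_norm_sq, hy] at h1
      nlinarith [norm_nonneg (A α y)]
    refine ⟨(1 / √2 : ℝ) • (y + A α y), ?_, focalLin_half_add hε hBy hz⟩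
    -- The involution `A α` swaps `y` and `A α y`, so it fixes their sum.
    refine mem_unitSet_of_lincomb hA (norm_half_add hy hz1 hyz) (c := Pi.single α 1) ?_ ?_
    · simp [Pi.single_apply]
    · have h1 : lincomb A (Pi.single α 1) = A α := by
        simp [lincomb, Pi.single_apply]
      rw [h1, map_smul, map_add, hA.apply_apply, add_comm]
  · intro x hx w hw hxw
    obtain ⟨hxw0, -⟩ := inner_eq_zero_of_inner_focalLin hB hε hw hxw
    set T := lincomb A (quadCoeff A x) with hT
    have hTT : T (T w) = w := by
      rw [hT, hA.lincomb_lincomb, show ∑ α, quadCoeff A x α ^ 2 = 1 from hx.2, one_smul]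
    have hz : B (T w) = -(ε • T w) := by rw [hT, hBP, hw, map_smul]
    -- Since `T` anticommutes with `B`, `T w` is in the opposite eigenspace. The lift is fixed by
    -- `T`: directions inside the `1`-eigenspace of `T` already suffice.
    refine ⟨(1 / √2 : ℝ) • (w + T w), ?_, focalLin_half_add hε hw hz⟩
    set v := (1 / √2 : ℝ) • (w + T w) with hv
    have hTv : T v = v := by rw [hv, map_smul, map_add, hTT, add_comm]
    have hxv : inner ℝ x v = 0 := by
      rw [hv, inner_smul_right, inner_add_right, ← hA.lincomb_isSymmetric,
        lincomb_quadCoeff hA hx, hxw0]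
      simp
    have hAv : ∀ α, inner ℝ (A α x) v = 0 := by
      intro α
      have h1 : inner ℝ (A α x) (T v) = -inner ℝ (A α x) v := by
        rw [← hA.lincomb_isSymmetric, hA.lincomb_map, lincomb_quadCoeff hA hx, inner_sub_left,
          inner_smul_left, hxv]
        simp
      rw [hTv] at h1
      linarith
    rw [unitSetProj_eq_self_iff hA hx]
    refine ⟨hxv, ?_⟩
    rw [← hT, hTv]
    simp [hAv]

end FocalMapsOfCliffordFamilies

/-! ### Translation from matrices to operator families. -/

theorem map_eq_smul_iff_inner {E : Type*} [NormedAddCommGroup E] [InnerProductSpace ℝ E]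
    {B : E →ₗ[ℝ] E} (hB : B.IsSymmetric) (hBB : ∀ x, B (B x) = x) {ε : ℝ} (hε : ε * ε = 1) {y : E}
    (hy : ‖y‖ = 1) : B y = ε • y ↔ inner ℝ (B y) y = ε := by
  constructor
  · intro h
    rw [h, inner_smul_left, real_inner_self_eq_norm_sq, hy]
    simp
  · intro h
    have h1 : inner ℝ (B y) (B y) = 1 := by
      rw [hB, hBB, real_inner_self_eq_norm_sq, hy, one_pow]
    -- Here `‖B y - ε y‖² = 1 - 2 ε² + ε² = 0`.
    rw [← sub_eq_zero, ← inner_self_eq_zero (𝕜 := ℝ)]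
    rw [inner_sub_left, inner_sub_right, inner_sub_right, inner_smul_left, inner_smul_right,
      inner_smul_left, inner_smul_right, h1, real_inner_comm (B y), h, real_inner_self_eq_norm_sq,
      hy, RCLike.conj_to_real]
    linear_combination -hε

variable {m l : ℕ} {P : Fin (m + 1) → Matrix (Fin (2 * l)) (Fin (2 * l)) ℝ}

theorem IsSymmetricCliffordSystem.cliffordFamily (hP : IsSymmetricCliffordSystem P) :
    CliffordFamily fun α => Matrix.toEuclideanLin (P α) where
  symm α := by
    rw [Matrix.isSymmetric_toEuclideanLin_iff, Matrix.IsHermitian,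
      Matrix.conjTranspose_eq_transpose_of_trivial]
    exact hP.symm α
  anticomm α β x := by
    have h := congrArg (fun Q => Matrix.toEuclideanLin Q x) (hP.anticomm α β)
    have hmul : ∀ Q R : Matrix (Fin (2 * l)) (Fin (2 * l)) ℝ, Matrix.toEuclideanLin (Q * R) x =
        Matrix.toEuclideanLin Q (Matrix.toEuclideanLin R x) := by
      intro Q R
      simp [Matrix.toLpLin_apply, Matrix.mulVec_mulVec]
    simp only [map_add, LinearMap.add_apply, hmul, map_smul, LinearMap.smul_apply] at h
    rw [h]
    have hone : Matrix.toEuclideanLin (1 : Matrix (Fin (2 * l)) (Fin (2 * l)) ℝ) x = x := by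
      simp
    rw [hone]
    split_ifs <;> simp

/-- The operators `P_0, …, P_i`. -/
noncomputable abbrev initialFamily (P : Fin (m + 1) → Matrix (Fin (2 * l)) (Fin (2 * l)) ℝ) (i : ℕ)
    (α : {α : Fin (m + 1) // (α : ℕ) ≤ i}) :
    EuclideanSpace ℝ (Fin (2 * l)) →ₗ[ℝ] EuclideanSpace ℝ (Fin (2 * l)) :=
  Matrix.toEuclideanLin (P α)

theorem card_initial {i : ℕ} (hi : i ≤ m) :
    Fintype.card {α : Fin (m + 1) // (α : ℕ) ≤ i} = i + 1 := by
  rw [Fintype.card_subtype]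
  have : (Finset.univ.filter fun α : Fin (m + 1) => (α : ℕ) ≤ i) =
      Finset.Iic (⟨i, Nat.lt_succ_of_le hi⟩ : Fin (m + 1)) := by
    ext α
    simp [Fin.le_def]
  rw [this, Fin.card_Iic]

theorem cliffordM_eq_zeroSet (i : ℕ) : cliffordM P i = zeroSet (initialFamily P i) := by
  ext x
  simp [cliffordM, zeroSet, quadForm]

theorem cliffordN_eq_unitSet (i : ℕ) : cliffordN P i = unitSet (initialFamily P i) := by
  ext x
  have h : ∑ α : Fin (m + 1) with α.val ≤ i, quadForm (P α) x ^ 2 =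
      ∑ α : {α : Fin (m + 1) // (α : ℕ) ≤ i}, inner ℝ (initialFamily P i α x) x ^ 2 :=
    Finset.sum_subtype _ (by simp) _
  simp only [cliffordN, unitSet, Set.mem_ofPred_eq, h]
  simp

/-- `P α` carries `y` into the opposite, hence orthogonal, eigenspace of `P t`. So unit eigenvectors
of `P t` satisfy the other conditions in the focal sets automatically. -/
theorem IsSymmetricCliffordSystem.quadForm_eq_zero (hP : IsSymmetricCliffordSystem P)
    {α t : Fin (m + 1)} (hα : α ≠ t) {ε : ℝ} (hε : ε * ε = 1) {y : EuclideanSpace ℝ (Fin (2 * l))}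
    (hy : Matrix.toEuclideanLin (P t) y = ε • y) : quadForm (P α) y = 0 := by
  have hA := hP.cliffordFamily
  rw [quadForm, real_inner_comm]
  refine inner_eq_zero_of_opposite (hA.symm t) hε hy ?_
  have h1 := hA.apply_apply_of_ne hα.symm y
  rw [h1, hy, map_smul]

theorem cliffordM_eigen_eq (hP : IsSymmetricCliffordSystem P) {i : ℕ} {t : Fin (m + 1)}
    (ht : i < t) {ε : ℝ} (hε : ε * ε = 1) :
    {y | y ∈ cliffordM P i ∧ quadForm (P t) y = ε} =
      {y | ‖y‖ = 1 ∧ Matrix.toEuclideanLin (P t) y = ε • y} := by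
  have hA := hP.cliffordFamily
  ext y
  constructor
  · rintro ⟨⟨hy, -⟩, h⟩
    have hy' : ‖y‖ = 1 := by simpa using hy
    exact ⟨hy', (map_eq_smul_iff_inner (hA.symm t) (hA.apply_apply t) hε hy').2 h⟩
  · rintro ⟨hy, h⟩
    refine ⟨⟨by simpa using hy, fun α hα => hP.quadForm_eq_zero ?_ hε h⟩,
      (map_eq_smul_iff_inner (hA.symm t) (hA.apply_apply t) hε hy).1 h⟩
    rintro rfl
    omega

theorem cliffordN_eigen_eq (hP : IsSymmetricCliffordSystem P) {i : ℕ} {t : Fin (m + 1)}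
    (ht : t ≤ i) {ε : ℝ} (hε : ε * ε = 1) :
    {y | y ∈ cliffordN P i ∧ quadForm (P t) y = ε} =
      {y | ‖y‖ = 1 ∧ Matrix.toEuclideanLin (P t) y = ε • y} := by
  have hA := hP.cliffordFamily
  ext y
  constructor
  · rintro ⟨⟨hy, -⟩, h⟩
    have hy' : ‖y‖ = 1 := by simpa using hy
    exact ⟨hy', (map_eq_smul_iff_inner (hA.symm t) (hA.apply_apply t) hε hy').2 h⟩
  · rintro ⟨hy, h⟩
    have ht1 : quadForm (P t) y = ε :=
      (map_eq_smul_iff_inner (hA.symm t) (hA.apply_apply t) hε hy).1 h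
    refine ⟨⟨by simpa using hy, ?_⟩, ht1⟩
    rw [Finset.sum_eq_single_of_mem t (by simpa using ht), ht1, sq, hε]
    intro α _ hα
    rw [hP.quadForm_eq_zero hα hε h]
    norm_num

end FocalEigenmap

/-! ### The main theorem. -/

theorem theorem1p4 {m l : ℕ} (P : Fin (m + 1) → Matrix (Fin (2 * l)) (Fin (2 * l)) ℝ)
    (hP : FocalEigenmap.IsSymmetricCliffordSystem P) :
    (∀ (i : ℕ) (hi : i + 1 ≤ m), i + 2 ≤ l →
      FocalEigenmap.IsEmbeddedSubmanifold (FocalEigenmap.cliffordM P (i + 1)) (2 * l - i - 3) ∧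
      ∀ ε : ℝ, ε = 1 ∨ ε = -1 →
        FocalEigenmap.IsSubmersiveEigenmapOnto
          (FocalEigenmap.cliffordM P (i + 1)) (2 * l - i - 3) l
          (FocalEigenmap.focalMap (P ⟨i + 1, Nat.lt_succ_of_le hi⟩) ε)
          {y | y ∈ FocalEigenmap.cliffordM P i ∧
            FocalEigenmap.quadForm (P ⟨i + 1, Nat.lt_succ_of_le hi⟩) y = ε}
          (2 * (l : ℝ) - (i : ℝ) - 3)) ∧
    (∀ (i : ℕ) (hi : i ≤ m), 2 ≤ i →
      FocalEigenmap.IsEmbeddedSubmanifold (FocalEigenmap.cliffordN P (i - 1)) (l + i - 2) ∧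
      ∀ ε : ℝ, ε = 1 ∨ ε = -1 →
        FocalEigenmap.IsSubmersiveEigenmapOnto
          (FocalEigenmap.cliffordN P (i - 1)) (l + i - 2) l
          (FocalEigenmap.focalMap (P ⟨i, Nat.lt_succ_of_le hi⟩) ε)
          {y | y ∈ FocalEigenmap.cliffordN P i ∧
            FocalEigenmap.quadForm (P ⟨i, Nat.lt_succ_of_le hi⟩) y = ε}
          ((l : ℝ) + (i : ℝ) - 2)) := by
  have hE : Module.finrank ℝ (EuclideanSpace ℝ (Fin (2 * l))) = 2 * l := by simp
  have hA := hP.cliffordFamily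
  have hε' : ∀ ε : ℝ, ε = 1 ∨ ε = -1 → ε * ε = 1 := by
    rintro ε (rfl | rfl) <;> norm_num
  constructor
  · intro i hi hil
    have hfam : FocalEigenmap.CliffordFamily (FocalEigenmap.initialFamily P (i + 1)) :=
      hA.comp Subtype.val_injective
    have hcard : Fintype.card {α : Fin (m + 1) // (α : ℕ) ≤ i + 1} = i + 2 :=
      FocalEigenmap.card_initial hi
    -- The natural subtraction is exact because `i + 2 ≤ l`.
    have hd : 2 * l = 2 * l - i - 3 + 1 +
        Fintype.card {α : Fin (m + 1) // (α : ℕ) ≤ i + 1} := by omega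
    rw [FocalEigenmap.cliffordM_eq_zeroSet (i + 1)]
    refine ⟨FocalEigenmap.zeroSet_isEmbeddedSubmanifold hfam (hE.trans hd), fun ε hε => ?_⟩
    rw [FocalEigenmap.cliffordM_eigen_eq hP (Nat.lt_succ_self i) (hε' ε hε)]
    have h := FocalEigenmap.zeroSet_isSubmersiveEigenmapOnto hfam
      ⟨⟨i + 1, Nat.lt_succ_of_le hi⟩, le_rfl⟩
      (hε' ε hε) hE hd (by omega) (by omega)
    have hcast : ((2 * l - i - 3 : ℕ) : ℝ) = 2 * (l : ℝ) - (i : ℝ) - 3 := by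
      rw [Nat.sub_sub, Nat.cast_sub (by omega)]
      push_cast
      ring
    rw [← hcast]
    exact h
  · intro i hi hi2
    set t : Fin (m + 1) := ⟨i, Nat.lt_succ_of_le hi⟩ with ht
    have hfam : FocalEigenmap.CliffordFamily (FocalEigenmap.initialFamily P (i - 1)) :=
      hA.comp Subtype.val_injective
    have hcard : Fintype.card {α : Fin (m + 1) // (α : ℕ) ≤ i - 1} = i - 1 + 1 :=
      FocalEigenmap.card_initial (by omega)
    have hd : l + i - 2 + 2 = l + Fintype.card {α : Fin (m + 1) // (α : ℕ) ≤ i - 1} := by omega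
    have hne : ∀ α : {α : Fin (m + 1) // (α : ℕ) ≤ i - 1}, (α : Fin (m + 1)) ≠ t := by
      rintro ⟨α, hα⟩ rfl
      simp only [ht] at hα
      omega
    have : Nonempty {α : Fin (m + 1) // (α : ℕ) ≤ i - 1} := ⟨⟨0, by simp⟩⟩
    have htr : ∀ α, LinearMap.trace ℝ _ (FocalEigenmap.initialFamily P (i - 1) α) = 0 := fun α =>
      hA.trace_eq_zero (hne α)
    rw [FocalEigenmap.cliffordN_eq_unitSet (i - 1)]
    refine ⟨FocalEigenmap.unitSet_isEmbeddedSubmanifold hfam htr hE hd, fun ε hε => ?_⟩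
    rw [FocalEigenmap.cliffordN_eigen_eq hP (le_refl i) (hε' ε hε)]
    -- The family is `P_0, …, P_{i-1}`, and `P_i` is the further operator anticommuting with all of
    -- it.
    have h := FocalEigenmap.unitSet_isSubmersiveEigenmapOnto hfam (hA.symm t) (hA.apply_apply t)
      (fun α x => hA.apply_apply_of_ne (hne α).symm x) htr
      (hA.trace_eq_zero (hne (Classical.arbitrary _)).symm) (hε' ε hε) hE hd
    have hcast : ((l + i - 2 : ℕ) : ℝ) = (l : ℝ) + (i : ℝ) - 2 := by
      rw [Nat.cast_sub (by omega)]
      push_cast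
      ring
    rw [← hcast]
    exact h
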